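/- **Setting.** Let $y\sim N_n(\mu,I)$ with $\mu\in\mathbb R^n$, $n\ge 1$, let $|y|_{(1)}\ge\dots\ge|y|_{(n)}$ be the decreasing rearrangement of the $|y_i|$, and let $z(a)$ be the upper $a$-quantile of $N(0,1)$, that is, $P(Z>z(a))=a$. Given false discovery rates $q_n\in(0,1)$, put $t_k=z\big(\tfrac{q_n}{2}\cdot\tfrac kn\big)$ for real $k$ with $0<k\le n$. Define: * $\hat k_F$, the largest $k\in\{1,\dots,n\}$ with $|y|_{(k)}\ge t_k$ ($\hat k_F=0$ if there is none); * $\hat k_G$, the leftmost local minimum over $k\in\{0,\dots,n\}$ of $S_k=\sum_{l=k+1}^n|y|_{(l)}^2+\sum_{l=1}^k t_l^2$ (local minimum: $S_k\le S_j$ for each neighbour $j=k\pm1$ in $\{0,\dots,n\}$); * the mean exceedance function $M(k;\mu)=\sum_{l=1}^n P_\mu(|y_l|\ge t_k)$ and the mean discovery number $k(\mu)=\inf\{k>0: M(k;\mu)=k\}$, with $k(0)=0$ (for $\mu=0$ the set is empty). **Parameter spaces.** For $0<\eta<1$ and $0<p<2$ let $$\ell_0[\eta]=\{\mu:\#\{i:\mu_i\ne0\}\le\eta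 n\},\qquad \ell_p[\eta]=\Big\{\mu:\tfrac1n\sum_{i}|\mu_i|^p\le\eta^p\Big\},$$ $$m_p[\eta]=\{\mu:|\mu|_{(k)}\le\eta\, n^{1/p}k^{-1/p},\ 1\le k\le n\}.$$ Put $\tau_\eta=\sqrt{2\log\eta^{-1}}$, $k_n=n\eta$ for $\ell_0[\eta]$, and $\tau_\eta=\sqrt{2\log\eta^{-p}}$, $k_n=n\eta^p\tau_\eta^{-p}$ for $\ell_p[\eta]$ and $m_p[\eta]$. **Assumptions.** Let $b_1,b_2,b_3>0$ be constants. * (Q) $q_n\to q\in[0,1)$, and if $q=0$ then $q_n\ge b_1/\log n$ for all $n\ge2$. * (H) $\eta$ (for $\ell_0[\eta]$), respectively $\eta^p$ (for $\ell_p[\eta]$ and $m_p[\eta]$), lies in $[n^{-1}\log^5 n,\ b_2n^{-b_3}]$. * (A) $\alpha_n=1/(b_4\tau_\eta)$ with $b_4=(1-q)/4$. Define the brackets $$k_-(\mu)=\begin{cases}k(\mu)-\alpha_nk_n,&k(\mu)\ge2\alpha_nk_n,\\0,&k(\mu)<2\alpha_nk_n,\end{cases}\qquad k_+(\mu)=\max\{k(\mu),\alpha_nk_n\}+\alpha_nk_n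 .$$ **Proposition.** Let the sequence $(q_n)$ satisfy (Q). There are constants $c_0,c_1>0$, depending only on the sequence $(q_n)$ and on $b_1,b_2,b_3$, such that for every $n\ge1$ and every parameter space $\Theta$ among $\ell_0[\eta]$, $\ell_p[\eta]$, $m_p[\eta]$ ($0<\eta<1$, $0<p<2$) satisfying (H) at $n$, the following holds for all $\mu\in\Theta$: one has $k_+(\mu)-k_-(\mu)\le3\alpha_nk_n$, and with $P_\mu$-probability at least $1-c_0\exp(-c_1\log^2 n)$, $$k_-(\mu)\le\hat k_G\le\hat k_F\le k_+(\mu)\qquad\text{and}\qquad \hat k_F-\hat k_G\le3\alpha_nk_n .$$ -/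

import Mathlib

open MeasureTheory ProbabilityTheory Filter Topology

noncomputable section

namespace FDRSandwich

/-- Right tail of the standard normal law, `P(Z > x)`. -/
def gaussTail (x : ℝ) : ℝ := (gaussianReal 0 1).real (Set.Ioi x)

/-- Upper quantile `z(a)` of the standard normal law: for `0 < a < 1` it is the point at which
the right tail equals `a`. -/
def upperQuantile (a : ℝ) : ℝ := sInf {x : ℝ | gaussTail x ≤ a}

/-- The quantile boundary `t_k = z((q / 2) (k / n))`, with `k` a real variable. -/
def threshold (qn : ℝ) (n : ℕ) (k : ℝ) : ℝ := upperQuantile (qn / 2 * (k / n))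

/-- Decreasing rearrangement of the absolute values; the value at the index `i : Fin n`
(counted from zero) is the `(i + 1)`-st largest of the `|y_j|`. -/
def orderedAbs {n : ℕ} (y : Fin n → ℝ) (i : Fin n) : ℝ :=
  |y (Tuple.sort (fun j => -|y j|) i)|

/-- The law `N_n(μ, I)`. -/
def normalLaw {n : ℕ} (μ : Fin n → ℝ) : Measure (Fin n → ℝ) :=
  Measure.pi (fun i => gaussianReal (μ i) 1)

/-- The FDR index: the largest `k` in `{1, …, n}` with `|y|_(k) ≥ t_k`, and `0` if there is none. -/
def kF (qn : ℝ) {n : ℕ} (y : Fin n → ℝ) : ℕ :=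
  sSup {k : ℕ | ∃ i : Fin n, k = (i : ℕ) + 1 ∧ threshold qn n k ≤ orderedAbs y i}

/-- The empirical complexity `S_k = ∑_{l = k+1}^n |y|_(l)^2 + ∑_{l = 1}^k t_l^2`
(the index `l` is `i + 1`). -/
def complexity (qn : ℝ) {n : ℕ} (y : Fin n → ℝ) (k : ℕ) : ℝ :=
  (∑ i : Fin n, if k < (i : ℕ) + 1 then orderedAbs y i ^ 2 else 0) +
    ∑ l ∈ Finset.Icc 1 k, threshold qn n l ^ 2

/-- `k` is a local minimum of `S` on `{0, …, n}`. -/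
def IsLocMin (qn : ℝ) {n : ℕ} (y : Fin n → ℝ) (k : ℕ) : Prop :=
  k ≤ n ∧ (∀ j ≤ n, (j + 1 = k ∨ j = k + 1) → complexity qn y k ≤ complexity qn y j)

/-- The step-down FDR index: the leftmost local minimum of `S`. -/
def kG (qn : ℝ) {n : ℕ} (y : Fin n → ℝ) : ℕ := sInf {k : ℕ | IsLocMin qn y k}

/-- The mean exceedance function `M(k; μ) = ∑_l P_μ(|y_l| ≥ t_k)`. -/
def meanExceed (qn : ℝ) {n : ℕ} (μ : Fin n → ℝ) (k : ℝ) : ℝ :=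
  ∑ l : Fin n, (gaussianReal (μ l) 1).real {x : ℝ | threshold qn n k ≤ |x|}

/-- The mean discovery number `k(μ) = inf {k > 0 : M(k; μ) = k}`. The set is empty exactly for
`μ = 0` (when `n ≥ 1` and `0 < q < 1`), and then `k(μ) = 0`. -/
def meanDiscovery (qn : ℝ) {n : ℕ} (μ : Fin n → ℝ) : ℝ :=
  sInf {k : ℝ | 0 < k ∧ meanExceed qn μ k = k}

/-- `τ_η = (2 log(1/ε))^{1/2}`, where `ε = η` for `ℓ_0` balls and `ε = η^p` for `ℓ_p`, `m_p`. -/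
def tau (ε : ℝ) : ℝ := √(2 * Real.log ε⁻¹)

/-- `α_n = 1 / (b₄ τ)` with `b₄ = (1 - q) / 4`, where `q` is the limiting false discovery rate. -/
def alpha (q τ : ℝ) : ℝ := 1 / ((1 - q) / 4 * τ)

/-- Lower bracket; `w` stands for `α_n k_n`. -/
def kMinus (qn : ℝ) {n : ℕ} (w : ℝ) (μ : Fin n → ℝ) : ℝ :=
  if 2 * w ≤ meanDiscovery qn μ then meanDiscovery qn μ - w else 0

/-- Upper bracket; `w` stands for `α_n k_n`. -/
def kPlus (qn : ℝ) {n : ℕ} (w : ℝ) (μ : Fin n → ℝ) : ℝ :=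
  max (meanDiscovery qn μ) w + w

/-- The `ℓ_0` ball: at most a proportion `η` of the coordinates is nonzero. -/
def l0Ball (n : ℕ) (η : ℝ) : Set (Fin n → ℝ) :=
  {μ | (((Finset.univ.filter fun i => μ i ≠ 0).card : ℕ) : ℝ) ≤ η * n}

/-- The strong `ℓ_p` ball of average radius `η`. -/
def lpBall (n : ℕ) (p η : ℝ) : Set (Fin n → ℝ) :=
  {μ | 1 / (n : ℝ) * ∑ i, |μ i| ^ p ≤ η ^ p}

/-- The weak `ℓ_p` ball `{μ : |μ|_(k) ≤ η n^{1/p} k^{-1/p}, 1 ≤ k ≤ n}`. -/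
def mpBall (n : ℕ) (p η : ℝ) : Set (Fin n → ℝ) :=
  {μ | ∀ i : Fin n,
    orderedAbs μ i ≤ η * (n : ℝ) ^ (1 / p) * (((i : ℕ) + 1 : ℕ) : ℝ) ^ (-1 / p)}

/-- The assumption on the false discovery rates `q_n`, with limit `q` and constant `b₁`. -/
structure RateAssumption (qs : ℕ → ℝ) (q b₁ : ℝ) : Prop where
  mem : ∀ n, 0 < qs n ∧ qs n < 1
  nonneg : 0 ≤ q
  lt_one : q < 1
  tendsto : Tendsto qs atTop (𝓝 q)
  lower : q = 0 → ∀ n : ℕ, 2 ≤ n → b₁ / Real.log n ≤ qs n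

/-- The sparsity assumption at sample size `n`: `ε` lies in `[n⁻¹ log⁵ n, b₂ n^{-b₃}]`. -/
def SparsityAssumption (b₂ b₃ : ℝ) (n : ℕ) (ε : ℝ) : Prop :=
  (n : ℝ)⁻¹ * Real.log n ^ 5 ≤ ε ∧ ε ≤ b₂ * (n : ℝ) ^ (-b₃)

/-- The event that `k_-(μ) ≤ k̂_G ≤ k̂_F ≤ k_+(μ)` and `k̂_F - k̂_G ≤ 3 α_n k_n`
(`w` stands for `α_n k_n`). -/
def sandwichEvent (qn : ℝ) {n : ℕ} (w : ℝ) (μ : Fin n → ℝ) : Set (Fin n → ℝ) :=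
  {y | kMinus qn w μ ≤ (kG qn y : ℝ) ∧ kG qn y ≤ kF qn y ∧ (kF qn y : ℝ) ≤ kPlus qn w μ ∧
    (kF qn y : ℝ) - (kG qn y : ℝ) ≤ 3 * w}

/-- The sandwich bound over the parameter set `Θ` at sample size `n`: the brackets are at most
`3 α_n k_n` apart, and the sandwich event fails with probability at most
`c₀ exp(-c₁ log² n)`, for every `μ ∈ Θ`. -/
def SandwichOn (c₀ c₁ qn : ℝ) {n : ℕ} (w : ℝ) (Θ : Set (Fin n → ℝ)) : Prop :=
  ∀ μ ∈ Θ, kPlus qn w μ - kMinus qn w μ ≤ 3 * w ∧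
    normalLaw μ (sandwichEvent qn w μ)ᶜ ≤
      ENNReal.ofReal (c₀ * Real.exp (-c₁ * Real.log n ^ 2))

end FDRSandwich

end

/-!
Write `N_k` for the number of coordinates with `|y_l| ≥ t_k`; its mean is `M(k) = M(k; μ)`. Since
`k̂_F` is the largest `k` with `N_k ≥ k`, and since every `k ≤ k̂_G` has `|y|_(k) ≥ t_k`, the
inequality `k̂_G ≤ k̂_F` always holds (`kG_le_kF`). The event `k̂_F > k_+` requires `N_k ≥ k` for
some `k > k_+`, and `k̂_G < k_-` requires fewer than `k` coordinates beyond `t_k` for some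
`k < k_- + 1`. Counts of independent events obey Chernoff bounds (`measure_card_ge_le`,
`measure_card_le_le`), so it suffices that `M(k)` lies well below `k` beyond `k_+` and well above
`k` up to `k_-`, and to add up over at most `n` values of `k`.

*Shape of `M`.* The power of the test `|y_l| ≥ t`, as a function of its level, is concave with
slope the likelihood ratio at `t` (`exceedProb_le_tangent`). As the level of `t_k` is linear in
`k`, `M` is concave (`meanExceed_le_tangent`), `M(k) / k` is nonincreasing, and `k(μ)` separates
the region `M(k) ≥ k` from the region `M(k) ≤ k`.

*Slope at `w = α_n k_n`.* All three parameter spaces satisfy `#{l : |μ_l| > s} ≤ n ε s⁻ᵖ`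
(`IsSparse`), with `p = 0` for `ℓ_0`. Let `T = t_w`, which is close to `τ` or larger. Means of size
at most `4 T / 5` contribute to the slope and to `M(w) / w` hardly more than `q`
(`sum_smallRatio_le`): tiny means do so because their likelihood ratio is close to `1`, those of
intermediate size because there are so few of them. The at most `2 k_n` other means contribute to
the slope less than `(1 - q) / 2`, by the choice of `α_n`. Hence `M` has slope at most
`(1 + q) / 2` from `w` on (`Regime.meanSlope_le`), and `k(μ)` is at most of the order of `k_n`. The
distance of `M(k)` to `k` is then of the order of `(1 - q) w` outside the brackets and for
`k ≥ w`, and the Chernoff exponent is at least of the order of `w² / k_n`.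

*Small `k`.* For `k < w` concavity only gives `M(k) ≥ (1 + (1 - q) / 2) k`, which makes the Chernoff
exponent proportional to `M(k) ≥ M(1)`. A fixed share of `M(w) ≥ w` comes from means larger than
`4 T / 5`, and comparing hazard rates shows that their exceedance probabilities decay at most
like a power `ρ < 1` of the level, with `1 - ρ` close to `4 T / (5 t_1)`
(`gaussTail_sub_ge_rpow`). Thus `M(1)` is at least of the order of `w ^ (1 - ρ)`.

Under the sparsity assumption both exponents are eventually larger than `2 log² n`
(`SparseScale.le_exponent`, `SparseScale.le_exponent'`); small `n` are absorbed in `c₀`.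
-/

namespace FDRSandwich

/-! ### Tails of the normal law -/

/-- The standard normal density. -/
noncomputable def gaussDensity (x : ℝ) : ℝ := (√(2 * Real.pi))⁻¹ * Real.exp (-x ^ 2 / 2)

lemma gaussDensity_pos (x : ℝ) : 0 < gaussDensity x := by
  unfold gaussDensity; positivity

lemma gaussDensity_eq (x : ℝ) : gaussDensity x = gaussianPDFReal 0 1 x := by
  simp [gaussDensity, gaussianPDFReal]

lemma continuous_gaussDensity : Continuous gaussDensity := by
  unfold gaussDensity; fun_prop

lemma integrable_gaussDensity : Integrable gaussDensity := by
  have := integrable_gaussianPDFReal 0 1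
  rwa [← funext gaussDensity_eq] at this

lemma gaussTail_eq_integral (x : ℝ) : gaussTail x = ∫ y in Set.Ioi x, gaussDensity y := by
  rw [gaussTail, measureReal_def, gaussianReal_apply_eq_integral 0 one_ne_zero,
    ENNReal.toReal_ofReal (integral_nonneg (gaussianPDFReal_nonneg 0 1)),
    funext gaussDensity_eq]

lemma gaussTail_sub (x y : ℝ) : gaussTail x - gaussTail y = ∫ t in x..y, gaussDensity t := by
  rw [gaussTail_eq_integral, gaussTail_eq_integral]
  exact intervalIntegral.integral_Ioi_sub_Ioi' integrable_gaussDensity.integrableOn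
    integrable_gaussDensity.integrableOn

lemma hasDerivAt_gaussTail (x : ℝ) : HasDerivAt gaussTail (-gaussDensity x) x := by
  have h : gaussTail = fun x => gaussTail 0 - ∫ t in (0 : ℝ)..x, gaussDensity t := by
    funext x; rw [← gaussTail_sub]; ring
  rw [h]
  have := intervalIntegral.integral_hasDerivAt_right
    (continuous_gaussDensity.intervalIntegrable 0 x)
    (continuous_gaussDensity.stronglyMeasurableAtFilter _ _) continuous_gaussDensity.continuousAt
  simpa using this.const_sub (gaussTail 0)

lemma continuous_gaussTail : Continuous gaussTail :=
  continuous_iff_continuousAt.2 fun x => (hasDerivAt_gaussTail x).continuousAt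

lemma gaussTail_strictAnti : StrictAnti gaussTail :=
  strictAnti_of_deriv_neg fun x => by
    rw [(hasDerivAt_gaussTail x).deriv]; linarith [gaussDensity_pos x]

lemma tendsto_gaussTail : Tendsto gaussTail atTop (𝓝 0) := by
  have h : gaussTail = fun x => 1 - cdf (gaussianReal 0 1) x := by
    funext x
    rw [cdf_eq_real, gaussTail, ← Set.compl_Iic, probReal_compl_eq_one_sub measurableSet_Iic]
  rw [h]
  simpa using (tendsto_cdf_atTop (gaussianReal 0 1)).const_sub 1

lemma gaussTail_pos (x : ℝ) : 0 < gaussTail x :=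
  lt_of_le_of_lt (measureReal_nonneg (s := Set.Ioi (x + 1)))
    (gaussTail_strictAnti (lt_add_one x))

lemma gaussianReal_real_Ioi (m x : ℝ) :
    (gaussianReal m 1).real (Set.Ioi x) = gaussTail (x - m) := by
  have h := gaussianReal_map_add_const (μ := 0) (v := 1) m
  rw [zero_add] at h
  rw [← h, map_measureReal_apply (by fun_prop) measurableSet_Ioi, gaussTail]
  congr 1
  ext y
  simp [sub_lt_iff_lt_add]

lemma gaussianReal_real_Ici (m x : ℝ) :
    (gaussianReal m 1).real (Set.Ici x) = gaussTail (x - m) := by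
  rw [← gaussianReal_real_Ioi]
  have := nullSingletonClass_gaussianReal (μ := m) (v := 1) one_ne_zero
  exact measureReal_congr Ioi_ae_eq_Ici.symm

lemma gaussianReal_real_Iic (m x : ℝ) :
    (gaussianReal m 1).real (Set.Iic x) = gaussTail (m - x) := by
  have h := gaussianReal_map_neg (μ := -m) (v := 1)
  rw [neg_neg] at h
  rw [← h, map_measureReal_apply (by fun_prop) measurableSet_Iic]
  have : (fun y : ℝ => -y) ⁻¹' Set.Iic x = Set.Ici (-x) := by
    ext y; simp
  rw [this, gaussianReal_real_Ici]
  congr 1; ring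

lemma gaussTail_neg (x : ℝ) : gaussTail (-x) = 1 - gaussTail x := by
  have h := gaussianReal_real_Iic 0 x
  rw [zero_sub] at h
  rw [← h, gaussTail, ← Set.compl_Iic, probReal_compl_eq_one_sub measurableSet_Iic]
  ring

lemma gaussTail_zero : gaussTail 0 = 1 / 2 := by
  have := gaussTail_neg 0
  rw [neg_zero] at this; linarith

lemma hasDerivAt_gaussDensity (x : ℝ) : HasDerivAt gaussDensity (-(x * gaussDensity x)) x := by
  have h : HasDerivAt (fun x : ℝ => -x ^ 2 / 2) (-x) x := by
    have := ((hasDerivAt_pow 2 x).fun_neg).div_const 2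
    refine this.congr_deriv ?_
    push_cast; ring
  have := (h.exp).const_mul (√(2 * Real.pi))⁻¹
  refine this.congr_deriv ?_
  simp only [gaussDensity]; ring

lemma gaussDensity_le_zero (x : ℝ) : gaussDensity x ≤ gaussDensity 0 := by
  unfold gaussDensity
  refine mul_le_mul_of_nonneg_left (Real.exp_le_exp.2 ?_) (by positivity)
  nlinarith [sq_nonneg x]

lemma tendsto_gaussDensity : Tendsto gaussDensity atTop (𝓝 0) := by
  have h1 : Tendsto (fun x : ℝ => -x ^ 2 / 2) atTop atBot := by
    have := tendsto_neg_atTop_atBot.comp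
      ((tendsto_pow_atTop (α := ℝ) two_ne_zero).atTop_div_const (by norm_num : (0 : ℝ) < 2))
    refine this.congr fun x => ?_
    simp [neg_div]
  have := (Real.tendsto_exp_atBot.comp h1).const_mul (√(2 * Real.pi))⁻¹
  rwa [mul_zero] at this

/-- The upper Mills bound. -/
lemma gaussTail_le_div {x : ℝ} (hx : 0 < x) : gaussTail x ≤ gaussDensity x / x := by
  have hder : ∀ y ∈ Set.Ioi (0 : ℝ), HasDerivAt (fun y => gaussDensity y / y - gaussTail y)
      (-(gaussDensity y / y ^ 2)) y := by
    intro y hy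
    have hy' : y ≠ 0 := ne_of_gt hy
    have := ((hasDerivAt_gaussDensity y).div (hasDerivAt_id y) hy').sub (hasDerivAt_gaussTail y)
    refine this.congr_deriv ?_
    simp only [id]; field_simp; ring
  have hanti : AntitoneOn (fun y => gaussDensity y / y - gaussTail y) (Set.Ioi 0) := by
    refine antitoneOn_of_deriv_nonpos (convex_Ioi 0)
      (fun y hy => (hder y hy).continuousAt.continuousWithinAt) ?_ ?_
    · rw [interior_Ioi]
      exact fun y hy => (hder y hy).differentiableAt.differentiableWithinAt
    · rw [interior_Ioi]
      intro y hy
      rw [(hder y hy).deriv]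
      have := gaussDensity_pos y
      have : 0 ≤ gaussDensity y / y ^ 2 := by positivity
      linarith
  have hlim : Tendsto (fun y => gaussDensity y / y - gaussTail y) atTop (𝓝 0) := by
    simpa using (tendsto_gaussDensity.div_atTop tendsto_id).sub tendsto_gaussTail
  have h := le_of_tendsto hlim (b := gaussDensity x / x - gaussTail x)
    (by filter_upwards [eventually_ge_atTop x] with y hy
        exact hanti hx (lt_of_lt_of_le hx hy) hy)
  linarith

/-- The lower Mills bound; it also says that the hazard rate at `x ≥ 0` is at most `x + 1`. -/
lemma gaussDensity_le_mul {x : ℝ} (hx : 0 ≤ x) :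
    gaussDensity x ≤ (x + 1) * gaussTail x := by
  have hder : ∀ y ∈ Set.Ici (0 : ℝ), HasDerivAt (fun y => gaussTail y - gaussDensity y / (y + 1))
      (-(gaussDensity y * y / (y + 1) ^ 2)) y := by
    intro y hy
    have hy' : y + 1 ≠ 0 := by have : (0 : ℝ) ≤ y := hy; positivity
    have := (hasDerivAt_gaussTail y).sub ((hasDerivAt_gaussDensity y).div
      ((hasDerivAt_id y).add_const 1) hy')
    refine this.congr_deriv ?_
    simp only [id]; field_simp; ring
  have hanti : AntitoneOn (fun y => gaussTail y - gaussDensity y / (y + 1)) (Set.Ici 0) := by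
    refine antitoneOn_of_deriv_nonpos (convex_Ici 0)
      (fun y hy => (hder y hy).continuousAt.continuousWithinAt) ?_ ?_
    · rw [interior_Ici]
      exact fun y hy =>
        (hder y (Set.Ioi_subset_Ici_self hy)).differentiableAt.differentiableWithinAt
    · rw [interior_Ici]
      intro y hy
      rw [(hder y (Set.Ioi_subset_Ici_self hy)).deriv]
      have := gaussDensity_pos y
      have hy' : (0 : ℝ) < y := hy
      have : 0 ≤ gaussDensity y * y / (y + 1) ^ 2 := by positivity
      linarith
  have hlim : Tendsto (fun y => gaussTail y - gaussDensity y / (y + 1)) atTop (𝓝 0) := by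
    simpa using tendsto_gaussTail.sub
      (tendsto_gaussDensity.div_atTop (tendsto_atTop_add_const_right _ 1 tendsto_id))
  have h := le_of_tendsto hlim (b := gaussTail x - gaussDensity x / (x + 1))
    (by filter_upwards [eventually_ge_atTop x] with y hy
        exact hanti hx (le_trans hx hy) hy)
  rw [sub_nonneg, div_le_iff₀ (by positivity)] at h
  linarith

lemma gaussDensity_le_max_mul (x : ℝ) : gaussDensity x ≤ (max x 0 + 1) * gaussTail x := by
  rcases le_total 0 x with h | h
  · rw [max_eq_left h]; exact gaussDensity_le_mul h
  · rw [max_eq_right h, zero_add, one_mul]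
    calc gaussDensity x ≤ gaussDensity 0 := gaussDensity_le_zero x
      _ ≤ gaussTail 0 := by simpa using gaussDensity_le_mul le_rfl
      _ ≤ gaussTail x := gaussTail_strictAnti.antitone h

lemma gaussDensity_zero_le : gaussDensity 0 ≤ 2 / 5 := by
  have h : (5 / 2 : ℝ) ≤ √(2 * Real.pi) := by
    apply Real.le_sqrt_of_sq_le
    nlinarith [Real.pi_gt_d2]
  simp only [gaussDensity]
  norm_num
  calc (√Real.pi)⁻¹ * (√2)⁻¹ = (√(2 * Real.pi))⁻¹ := by
        rw [Real.sqrt_mul (by norm_num), mul_inv, mul_comm]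
    _ ≤ (5 / 2 : ℝ)⁻¹ := by gcongr
    _ = 2 / 5 := by norm_num

lemma le_gaussDensity_zero : (1 : ℝ) / 3 ≤ gaussDensity 0 := by
  have h : √(2 * Real.pi) ≤ 3 := by
    apply Real.sqrt_le_iff.2
    constructor
    · norm_num
    · nlinarith [Real.pi_lt_d2]
  have h0 : 0 < √(2 * Real.pi) := by positivity
  have : gaussDensity 0 = (√(2 * Real.pi))⁻¹ := by simp [gaussDensity]
  rw [this, one_div]
  gcongr

lemma gaussDensity_eq_zero_mul (x : ℝ) :
    gaussDensity x = gaussDensity 0 * Real.exp (-x ^ 2 / 2) := by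
  simp [gaussDensity]

/-! ### Quantiles -/

lemma exists_gaussTail_eq {a : ℝ} (h0 : 0 < a) (h1 : a < 1 / 2) :
    ∃ x, 0 < x ∧ gaussTail x = a := by
  obtain ⟨y, hy⟩ := ((tendsto_gaussTail.eventually_lt_const h0).and
    (eventually_ge_atTop 0)).exists
  obtain ⟨x, hx, hxa⟩ := intermediate_value_Icc' hy.2 continuous_gaussTail.continuousOn
    ⟨hy.1.le, by rw [gaussTail_zero]; exact h1.le⟩
  refine ⟨x, lt_of_le_of_ne hx.1 ?_, hxa⟩
  rintro rfl
  rw [gaussTail_zero] at hxa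
  linarith

lemma upperQuantile_gaussTail (x : ℝ) : upperQuantile (gaussTail x) = x := by
  have : {y : ℝ | gaussTail y ≤ gaussTail x} = Set.Ici x := by
    ext y; simp [gaussTail_strictAnti.le_iff_ge]
  rw [upperQuantile, this, csInf_Ici]

lemma gaussTail_upperQuantile {a : ℝ} (h0 : 0 < a) (h1 : a < 1 / 2) :
    gaussTail (upperQuantile a) = a := by
  obtain ⟨x, -, rfl⟩ := exists_gaussTail_eq h0 h1
  rw [upperQuantile_gaussTail]

lemma upperQuantile_pos {a : ℝ} (h0 : 0 < a) (h1 : a < 1 / 2) : 0 < upperQuantile a := by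
  obtain ⟨x, hx, rfl⟩ := exists_gaussTail_eq h0 h1
  rwa [upperQuantile_gaussTail]

section Threshold

variable {qn : ℝ} {n : ℕ} {k : ℝ}

lemma level_mem (h0 : 0 < qn) (h1 : qn < 1) (hk : 0 < k) (hkn : k ≤ n) :
    0 < qn / 2 * (k / n) ∧ qn / 2 * (k / n) < 1 / 2 := by
  have hn : (0 : ℝ) < n := hk.trans_le hkn
  refine ⟨by positivity, ?_⟩
  have : k / n ≤ 1 := (div_le_one hn).2 hkn
  have h2 : 0 < k / n := by positivity
  nlinarith

lemma threshold_pos (h0 : 0 < qn) (h1 : qn < 1) (hk : 0 < k) (hkn : k ≤ n) :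
    0 < threshold qn n k :=
  let h := level_mem h0 h1 hk hkn
  upperQuantile_pos h.1 h.2

lemma gaussTail_threshold (h0 : 0 < qn) (h1 : qn < 1) (hk : 0 < k) (hkn : k ≤ n) :
    gaussTail (threshold qn n k) = qn / 2 * (k / n) :=
  let h := level_mem h0 h1 hk hkn
  gaussTail_upperQuantile h.1 h.2

lemma threshold_anti {k' : ℝ} (h0 : 0 < qn) (h1 : qn < 1) (hk : 0 < k) (hkk : k ≤ k')
    (hkn : k' ≤ n) : threshold qn n k' ≤ threshold qn n k := by
  have hn : (0 : ℝ) < n := (hk.trans_le hkk).trans_le hkn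
  rw [← gaussTail_strictAnti.le_iff_ge, gaussTail_threshold h0 h1 hk (hkk.trans hkn),
    gaussTail_threshold h0 h1 (hk.trans_le hkk) hkn]
  gcongr

end Threshold

/-! ### The two indices as functions of the data -/

section Deterministic

variable {qn : ℝ} {n : ℕ} {y : Fin n → ℝ}

lemma orderedAbs_antitone (y : Fin n → ℝ) : Antitone (orderedAbs y) := fun i j hij => by
  have := Tuple.monotone_sort (fun j => -|y j|) hij
  simpa [orderedAbs] using this

lemma orderedAbs_nonneg (y : Fin n → ℝ) (i : Fin n) : 0 ≤ orderedAbs y i := abs_nonneg _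

lemma succ_le_card_of_le_orderedAbs {t : ℝ} {i : Fin n} (h : t ≤ orderedAbs y i) :
    (i : ℕ) + 1 ≤ (Finset.univ.filter fun l => t ≤ |y l|).card := by
  rw [← Fin.card_Iic, ← Finset.card_map (Tuple.sort fun j => -|y j|).toEmbedding]
  refine Finset.card_le_card fun l hl => ?_
  obtain ⟨j, hj, rfl⟩ := Finset.mem_map.1 hl
  refine Finset.mem_filter.2 ⟨Finset.mem_univ _, ?_⟩
  exact h.trans (orderedAbs_antitone y (Finset.mem_Iic.1 hj))

lemma card_le_of_orderedAbs_le {t : ℝ} {i : Fin n} (h : orderedAbs y i ≤ t) :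
    (Finset.univ.filter fun l => t < |y l|).card ≤ i := by
  rw [← Fin.card_Iio i, ← Finset.card_map (s := Finset.Iio i)
    (Tuple.sort fun j => -|y j|).toEmbedding]
  refine Finset.card_le_card fun l hl => ?_
  replace hl := (Finset.mem_filter.1 hl).2
  refine Finset.mem_map.2 ⟨(Tuple.sort fun j => -|y j|).symm l, ?_, by simp⟩
  rw [Finset.mem_Iio]
  by_contra hcon
  have h1 := orderedAbs_antitone y (not_lt.1 hcon)
  have h2 : orderedAbs y ((Tuple.sort fun j => -|y j|).symm l) = |y l| := by simp [orderedAbs]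
  linarith

lemma complexity_succ_add (qn : ℝ) (y : Fin n → ℝ) (i : Fin n) :
    complexity qn y ((i : ℕ) + 1) + orderedAbs y i ^ 2 =
      complexity qn y i + threshold qn n ((i : ℕ) + 1 : ℕ) ^ 2 := by
  have h : ∀ j : Fin n, (if (i : ℕ) < (j : ℕ) + 1 then orderedAbs y j ^ 2 else 0) =
      (if (i : ℕ) + 1 < (j : ℕ) + 1 then orderedAbs y j ^ 2 else 0) +
        if j = i then orderedAbs y j ^ 2 else 0 := by
    intro j
    rcases lt_trichotomy (i : ℕ) (j : ℕ) with hlt | heq | hgt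
    · have : j ≠ i := fun h => by simp [h] at hlt
      simp [this, hlt, Nat.lt_succ_of_lt hlt]
    · have : j = i := Fin.ext heq.symm
      simp [this]
    · have h1 : j ≠ i := fun h => by simp [h] at hgt
      have h2 : ¬ (i : ℕ) < (j : ℕ) + 1 := by omega
      have h3 : ¬ (i : ℕ) < (j : ℕ) := by omega
      simp [h1, h2, h3]
  have h2 : ∑ j : Fin n, (if (i : ℕ) < (j : ℕ) + 1 then orderedAbs y j ^ 2 else 0) =
      ∑ j : Fin n, (if (i : ℕ) + 1 < (j : ℕ) + 1 then orderedAbs y j ^ 2 else 0) +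
        orderedAbs y i ^ 2 := by
    rw [Finset.sum_congr rfl fun j _ => h j, Finset.sum_add_distrib]
    simp
  rw [complexity, complexity, h2, Finset.sum_Icc_succ_top (by omega)]
  ring

lemma isLocMin_kG (qn : ℝ) (y : Fin n → ℝ) : IsLocMin qn y (kG qn y) := by
  obtain ⟨k, hk, hmin⟩ := Finset.exists_min_image (Finset.range (n + 1)) (complexity qn y)
    ⟨0, by simp⟩
  have : IsLocMin qn y k := ⟨by simpa [Nat.lt_succ_iff] using hk,
    fun j hj _ => hmin j (by simpa [Nat.lt_succ_iff] using hj)⟩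
  exact Nat.sInf_mem (s := {k : ℕ | IsLocMin qn y k}) ⟨k, this⟩

lemma bddAbove_kF_set (qn : ℝ) (y : Fin n → ℝ) :
    BddAbove {k : ℕ | ∃ i : Fin n, k = (i : ℕ) + 1 ∧ threshold qn n k ≤ orderedAbs y i} :=
  ⟨n, by rintro k ⟨i, rfl, -⟩; exact i.2⟩

lemma kG_le_kF (qn : ℝ) (y : Fin n → ℝ) : kG qn y ≤ kF qn y := by
  obtain ⟨hle, hmin⟩ := isLocMin_kG qn y
  rcases Nat.eq_zero_or_pos (kG qn y) with h | h
  · omega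
  obtain ⟨m, hm⟩ : ∃ m, kG qn y = m + 1 := ⟨kG qn y - 1, by omega⟩
  have hmn : m < n := by omega
  refine le_csSup (bddAbove_kF_set qn y) ⟨⟨m, hmn⟩, hm, ?_⟩
  have hc := hmin m (by omega) (Or.inl hm.symm)
  have hs := complexity_succ_add qn y ⟨m, hmn⟩
  simp only [← hm] at hs
  exact le_of_sq_le_sq (by linarith) (orderedAbs_nonneg _ _)

lemma kF_le_card (h : 0 < kF qn y) :
    kF qn y ≤ n ∧
      kF qn y ≤ (Finset.univ.filter fun l => threshold qn n (kF qn y) ≤ |y l|).card := by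
  have hne : {k : ℕ | ∃ i : Fin n,
      k = (i : ℕ) + 1 ∧ threshold qn n k ≤ orderedAbs y i}.Nonempty := by
    by_contra hcon
    rw [Set.not_nonempty_iff_eq_empty] at hcon
    rw [kF, hcon] at h
    simp at h
  obtain ⟨i, hi, hle⟩ := Nat.sSup_mem hne (bddAbove_kF_set qn y)
  change kF qn y = _ at hi
  change threshold qn n (kF qn y) ≤ _ at hle
  have := succ_le_card_of_le_orderedAbs hle
  exact ⟨by omega, by omega⟩

lemma card_le_kG (h0 : 0 < qn) (h1 : qn < 1) (h : kG qn y < n) :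
    (Finset.univ.filter fun l => threshold qn n (kG qn y + 1 : ℕ) < |y l|).card ≤ kG qn y := by
  obtain ⟨-, hmin⟩ := isLocMin_kG qn y
  have hc := hmin (kG qn y + 1) h (Or.inr rfl)
  have hs := complexity_succ_add qn y ⟨kG qn y, h⟩
  refine card_le_of_orderedAbs_le (i := ⟨kG qn y, h⟩) ?_
  have hpos : 0 < threshold qn n (kG qn y + 1 : ℕ) :=
    threshold_pos h0 h1 (by positivity) (by exact_mod_cast h)
  simp only at hs
  exact le_of_sq_le_sq (by linarith) hpos.le

end Deterministic

/-! ### Deviations of counts of independent events -/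

section Chernoff

variable {n : ℕ} (ν : Fin n → Measure ℝ) [∀ i, IsProbabilityMeasure (ν i)]

/-- The exponential moment of the number of coordinates falling in `A`, compared with the one of
a Poisson variable of the same mean. -/
lemma integral_exp_card_le {A : Set ℝ} (hA : MeasurableSet A) [DecidablePred (· ∈ A)] (r : ℝ) :
    Integrable (fun y : Fin n → ℝ =>
      Real.exp (r * (Finset.univ.filter fun l => y l ∈ A).card)) (Measure.pi ν) ∧
    ∫ y : Fin n → ℝ, Real.exp (r * (Finset.univ.filter fun l => y l ∈ A).card) ∂Measure.pi ν ≤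
      Real.exp ((∑ l, (ν l).real A) * (Real.exp r - 1)) := by
  have hfun : (fun y : Fin n → ℝ =>
      Real.exp (r * (Finset.univ.filter fun l => y l ∈ A).card)) =
      fun y => ∏ l, (1 + A.indicator (fun _ => Real.exp r - 1) (y l)) := by
    funext y
    rw [Finset.card_filter]
    push_cast
    rw [Finset.mul_sum, Real.exp_sum]
    refine Finset.prod_congr rfl fun l _ => ?_
    by_cases h : y l ∈ A <;> simp [h]
  have hint : ∀ l, Integrable (A.indicator (fun _ => Real.exp r - 1)) (ν l) := fun l =>
    (integrable_const _).indicator hA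
  rw [hfun]
  refine ⟨Integrable.fintype_prod (f := fun _ x => 1 + A.indicator (fun _ => Real.exp r - 1) x)
    fun l => (integrable_const _).add (hint l), ?_⟩
  rw [integral_fintype_prod_eq_prod
    (f := fun _ x => 1 + A.indicator (fun _ => Real.exp r - 1) x), Finset.sum_mul, Real.exp_sum]
  have hval : ∀ l, ∫ x, (1 + A.indicator (fun _ => Real.exp r - 1) x) ∂ν l =
      1 + (ν l).real A * (Real.exp r - 1) := fun l => by
    rw [integral_add (integrable_const _) (hint l), integral_indicator_const _ hA]
    simp
  refine Finset.prod_le_prod (fun l _ => ?_) (fun l _ => ?_)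
  · rw [hval]
    have h1 : (ν l).real A ≤ 1 := measureReal_le_one
    have h2 : 0 ≤ (ν l).real A := measureReal_nonneg
    nlinarith [Real.exp_pos r]
  · rw [hval]
    linarith [Real.add_one_le_exp ((ν l).real A * (Real.exp r - 1))]

/-- The upper deviation bound for the number of coordinates falling in `A`. -/
lemma measure_card_ge_le {A : Set ℝ} (hA : MeasurableSet A) [DecidablePred (· ∈ A)] {k : ℝ}
    (hk : 0 < k) (hM : ∑ l, (ν l).real A ≤ k) :
    (Measure.pi ν).real {y | k ≤ (Finset.univ.filter fun l => y l ∈ A).card} ≤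
      Real.exp (-((k - ∑ l, (ν l).real A) ^ 2 / (4 * k))) := by
  set M := ∑ l, (ν l).real A with hMdef
  have hM0 : 0 ≤ M := Finset.sum_nonneg fun l _ => measureReal_nonneg
  set r := (k - M) / (2 * k) with hr
  have hr0 : 0 ≤ r := div_nonneg (by linarith) (by linarith)
  have hr1 : r ≤ 1 := by
    rw [hr, div_le_one (by linarith)]; linarith
  obtain ⟨hint, hle⟩ := integral_exp_card_le ν hA r
  have hmark := mul_meas_ge_le_integral_of_nonneg (μ := Measure.pi ν)
    (Eventually.of_forall fun y => (Real.exp_pos _).le) hint (Real.exp (r * k))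
  have hsub : (Measure.pi ν).real {y | k ≤ (Finset.univ.filter fun l => y l ∈ A).card} ≤
      (Measure.pi ν).real {y | Real.exp (r * k) ≤
        Real.exp (r * (Finset.univ.filter fun l => y l ∈ A).card)} := by
    refine measureReal_mono fun y hy => ?_
    exact Real.exp_le_exp.2 (mul_le_mul_of_nonneg_left hy hr0)
  have h1 : Real.exp r - 1 ≤ r + r ^ 2 := by
    have := Real.abs_exp_sub_one_sub_id_le (x := r) (by rw [abs_of_nonneg hr0]; exact hr1)
    linarith [(abs_le.1 this).2]
  have h2 : (Measure.pi ν).real {y | k ≤ (Finset.univ.filter fun l => y l ∈ A).card} *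
      Real.exp (r * k) ≤ Real.exp (M * (r + r ^ 2)) := by
    refine le_trans ?_ (Real.exp_le_exp.2 (mul_le_mul_of_nonneg_left h1 hM0))
    refine le_trans ?_ hle
    rw [mul_comm]
    exact (mul_le_mul_of_nonneg_left hsub (Real.exp_pos _).le).trans hmark
  rw [← le_div_iff₀ (Real.exp_pos _), ← Real.exp_sub] at h2
  refine h2.trans (Real.exp_le_exp.2 ?_)
  have e : M * (r + r ^ 2) - r * k = -(r * (k - M)) + M * r ^ 2 := by ring
  have e2 : (k - M) ^ 2 / (4 * k) = k * r ^ 2 := by rw [hr]; field_simp; ring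
  have e3 : r * (k - M) = 2 * k * r ^ 2 := by rw [hr]; field_simp
  rw [e, e2, e3]
  nlinarith [sq_nonneg r]

/-- The lower deviation bound for the number of coordinates falling in `A`. -/
lemma measure_card_le_le {A : Set ℝ} (hA : MeasurableSet A) [DecidablePred (· ∈ A)] {k : ℝ}
    (hk : 0 ≤ k) (hM : k ≤ ∑ l, (ν l).real A) (hM0 : 0 < ∑ l, (ν l).real A) :
    (Measure.pi ν).real {y | ((Finset.univ.filter fun l => y l ∈ A).card : ℝ) ≤ k} ≤
      Real.exp (-((∑ l, (ν l).real A - k) ^ 2 / (4 * ∑ l, (ν l).real A))) := by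
  set M := ∑ l, (ν l).real A with hMdef
  set r := (M - k) / (2 * M) with hr
  have hr0 : 0 ≤ r := div_nonneg (by linarith) (by linarith)
  have hr1 : r ≤ 1 := by
    rw [hr, div_le_one (by linarith)]; linarith
  obtain ⟨hint, hle⟩ := integral_exp_card_le ν hA (-r)
  have hmark := mul_meas_ge_le_integral_of_nonneg (μ := Measure.pi ν)
    (Eventually.of_forall fun y => (Real.exp_pos _).le) hint (Real.exp (-r * k))
  have hsub : (Measure.pi ν).real {y | ((Finset.univ.filter fun l => y l ∈ A).card : ℝ) ≤ k} ≤
      (Measure.pi ν).real {y | Real.exp (-r * k) ≤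
        Real.exp (-r * (Finset.univ.filter fun l => y l ∈ A).card)} := by
    refine measureReal_mono fun y hy => ?_
    exact Real.exp_le_exp.2 (mul_le_mul_of_nonpos_left hy (by linarith))
  have h1 : Real.exp (-r) - 1 ≤ -r + r ^ 2 := by
    have := Real.abs_exp_sub_one_sub_id_le (x := -r) (by rw [abs_neg, abs_of_nonneg hr0]; exact hr1)
    linarith [(abs_le.1 this).2, neg_sq r]
  have h2 : (Measure.pi ν).real {y | ((Finset.univ.filter fun l => y l ∈ A).card : ℝ) ≤ k} *
      Real.exp (-r * k) ≤ Real.exp (M * (-r + r ^ 2)) := by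
    refine le_trans ?_ (Real.exp_le_exp.2 (mul_le_mul_of_nonneg_left h1 hM0.le))
    refine le_trans ?_ hle
    rw [mul_comm]
    exact (mul_le_mul_of_nonneg_left hsub (Real.exp_pos _).le).trans hmark
  rw [← le_div_iff₀ (Real.exp_pos _), ← Real.exp_sub] at h2
  refine h2.trans (Real.exp_le_exp.2 ?_)
  have e : M * (-r + r ^ 2) - -r * k = -(r * (M - k)) + M * r ^ 2 := by ring
  have e2 : (M - k) ^ 2 / (4 * M) = M * r ^ 2 := by rw [hr]; field_simp; ring
  have e3 : r * (M - k) = 2 * M * r ^ 2 := by rw [hr]; field_simp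
  rw [e, e2, e3]
  linarith

end Chernoff

/-! ### The power function of a two-sided test -/

/-- The probability that `|Z + m| ≥ t`, for `t > 0`. -/
noncomputable def exceedProb (m t : ℝ) : ℝ := gaussTail (t - m) + gaussTail (t + m)

/-- The likelihood ratio of `|Z + m|` to `|Z|` at the point `t ≥ 0`. -/
noncomputable def likelihoodRatio (m t : ℝ) : ℝ := Real.exp (-m ^ 2 / 2) * Real.cosh (m * t)

lemma measureReal_lt_abs (m t : ℝ) :
    (gaussianReal m 1).real {x | t < |x|} = (gaussianReal m 1).real {x | t ≤ |x|} := by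
  have := nullSingletonClass_gaussianReal (μ := m) (v := 1) one_ne_zero
  have h1 : {x : ℝ | t < |x|} = Set.Ioi t ∪ Set.Iio (-t) := by
    ext x; simp [lt_abs, lt_neg]
  have h2 : {x : ℝ | t ≤ |x|} = Set.Ici t ∪ Set.Iic (-t) := by
    ext x; simp [le_abs, le_neg]
  rw [h1, h2]
  exact measureReal_congr (Ioi_ae_eq_Ici.union Iio_ae_eq_Iic)

lemma measureReal_le_abs (m : ℝ) {t : ℝ} (ht : 0 < t) :
    (gaussianReal m 1).real {x | t ≤ |x|} = exceedProb m t := by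
  have h2 : {x : ℝ | t ≤ |x|} = Set.Ici t ∪ Set.Iic (-t) := by
    ext x; simp [le_abs, le_neg]
  have hd : Disjoint (Set.Ici t) (Set.Iic (-t)) :=
    Set.disjoint_left.2 fun x hx hx' => by
      simp only [Set.mem_Ici, Set.mem_Iic] at hx hx'; linarith
  rw [h2, measureReal_union hd measurableSet_Iic, gaussianReal_real_Ici, gaussianReal_real_Iic,
    exceedProb]
  congr 2
  ring

lemma exceedProb_abs (m t : ℝ) : exceedProb m t = exceedProb |m| t := by
  rcases abs_choice m with h | h <;> rw [h]
  simp [exceedProb, add_comm, sub_eq_add_neg]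

lemma exceedProb_antitone (m : ℝ) : Antitone (exceedProb m) := fun s t hst => by
  unfold exceedProb
  exact add_le_add (gaussTail_strictAnti.antitone (by linarith))
    (gaussTail_strictAnti.antitone (by linarith))

lemma exceedProb_le (m t : ℝ) : exceedProb m t ≤ 2 * gaussTail (t - |m|) := by
  rw [exceedProb_abs, exceedProb]
  have : gaussTail (t + |m|) ≤ gaussTail (t - |m|) :=
    gaussTail_strictAnti.antitone (by linarith [abs_nonneg m])
  linarith

lemma gaussTail_le_exceedProb (m t : ℝ) : gaussTail (t - |m|) ≤ exceedProb m t := by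
  rw [exceedProb_abs, exceedProb]
  linarith [gaussTail_pos (t + |m|)]

lemma tendsto_exceedProb (m : ℝ) : Tendsto (exceedProb m) atTop (𝓝 0) := by
  have h1 := tendsto_gaussTail.comp (tendsto_atTop_add_const_right atTop (-m) tendsto_id)
  have h2 := tendsto_gaussTail.comp (tendsto_atTop_add_const_right atTop m tendsto_id)
  have h := h1.add h2
  rw [add_zero] at h
  exact h.congr fun t => by simp [exceedProb, sub_eq_add_neg]

lemma likelihoodRatio_mono (m : ℝ) {s t : ℝ} (hs : 0 ≤ s) (hst : s ≤ t) :
    likelihoodRatio m s ≤ likelihoodRatio m t := by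
  unfold likelihoodRatio
  refine mul_le_mul_of_nonneg_left (Real.cosh_le_cosh.2 ?_) (Real.exp_pos _).le
  rw [abs_mul, abs_mul, abs_of_nonneg hs, abs_of_nonneg (hs.trans hst)]
  exact mul_le_mul_of_nonneg_left hst (abs_nonneg m)

lemma likelihoodRatio_le (m : ℝ) {t : ℝ} (ht : 0 ≤ t) :
    likelihoodRatio m t ≤ Real.exp (t * |m| - m ^ 2 / 2) := by
  have h : Real.cosh (m * t) ≤ Real.exp (t * |m|) := by
    rw [← Real.cosh_abs, abs_mul, abs_of_nonneg ht, Real.cosh_eq, mul_comm]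
    have : Real.exp (-(t * |m|)) ≤ Real.exp (t * |m|) :=
      Real.exp_le_exp.2 (by nlinarith [abs_nonneg m])
    linarith
  calc likelihoodRatio m t ≤ Real.exp (-m ^ 2 / 2) * Real.exp (t * |m|) :=
        mul_le_mul_of_nonneg_left h (Real.exp_pos _).le
    _ = _ := by rw [← Real.exp_add]; congr 1; ring

lemma gaussDensity_add (m t : ℝ) :
    gaussDensity (t - m) + gaussDensity (t + m) = 2 * (gaussDensity t * likelihoodRatio m t) := by
  have h1 : -(t - m) ^ 2 / 2 = -t ^ 2 / 2 + -m ^ 2 / 2 + m * t := by ring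
  have h2 : -(t + m) ^ 2 / 2 = -t ^ 2 / 2 + -m ^ 2 / 2 + -(m * t) := by ring
  simp only [gaussDensity, likelihoodRatio, h1, h2, Real.exp_add, Real.cosh_eq]
  ring

lemma hasDerivAt_exceedProb (m t : ℝ) :
    HasDerivAt (exceedProb m) (-(2 * (gaussDensity t * likelihoodRatio m t))) t := by
  have h1 := (hasDerivAt_gaussTail (t - m)).comp t ((hasDerivAt_id t).sub_const m)
  have h2 := (hasDerivAt_gaussTail (t + m)).comp t ((hasDerivAt_id t).add_const m)
  refine (h1.add h2).congr_deriv ?_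
  rw [← gaussDensity_add]; ring

/-- The power of the two-sided test, as a function of its level `2 * gaussTail t`, lies below its
tangent at `T`: the likelihood ratio, which is the slope, increases with the cut-off. -/
lemma exceedProb_le_tangent (m : ℝ) {t T : ℝ} (ht : 0 ≤ t) (hT : 0 ≤ T) :
    exceedProb m t ≤
      exceedProb m T + likelihoodRatio m T * (2 * gaussTail t - 2 * gaussTail T) := by
  set D : ℝ → ℝ := fun t => exceedProb m t - 2 * likelihoodRatio m T * gaussTail t with hD
  have hder : ∀ x, HasDerivAt D
      (2 * gaussDensity x * (likelihoodRatio m T - likelihoodRatio m x)) x := fun x => by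
    refine ((hasDerivAt_exceedProb m x).sub
      ((hasDerivAt_gaussTail x).const_mul (2 * likelihoodRatio m T))).congr_deriv ?_
    ring
  have hcont : Continuous D := continuous_iff_continuousAt.2 fun x => (hder x).continuousAt
  have hdiff : Differentiable ℝ D := fun x => (hder x).differentiableAt
  have key : D t ≤ D T := by
    rcases le_total t T with h | h
    · refine monotoneOn_of_deriv_nonneg (convex_Icc 0 T) hcont.continuousOn
        hdiff.differentiableOn ?_ ⟨ht, h⟩ ⟨hT, le_rfl⟩ h
      rw [interior_Icc]
      intro x hx
      rw [(hder x).deriv]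
      have := likelihoodRatio_mono m hx.1.le hx.2.le
      exact mul_nonneg (by linarith [gaussDensity_pos x]) (by linarith)
    · refine antitoneOn_of_deriv_nonpos (convex_Ici T) hcont.continuousOn
        hdiff.differentiableOn ?_ (Set.mem_Ici.2 le_rfl) h h
      rw [interior_Ici]
      intro x hx
      rw [(hder x).deriv]
      have := likelihoodRatio_mono m hT (le_of_lt hx)
      exact mul_nonpos_of_nonneg_of_nonpos (by linarith [gaussDensity_pos x]) (by linarith)
  simp only [hD] at key
  linarith

lemma likelihoodRatio_mul_le (m : ℝ) {T : ℝ} (hT : 0 ≤ T) :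
    likelihoodRatio m T * (2 * gaussTail T) ≤ exceedProb m T := by
  have h : Tendsto (fun t => exceedProb m T +
      likelihoodRatio m T * (2 * gaussTail t - 2 * gaussTail T) - exceedProb m t) atTop
      (𝓝 (exceedProb m T + likelihoodRatio m T * (2 * 0 - 2 * gaussTail T) - 0)) :=
    ((((tendsto_gaussTail.const_mul 2).sub_const _).const_mul _).const_add _).sub
      (tendsto_exceedProb m)
  have := ge_of_tendsto h (b := 0) (by
    filter_upwards [eventually_ge_atTop 0] with t ht
    linarith [exceedProb_le_tangent m ht hT])
  linarith

/-- A Gaussian tail shifted by `m` decays at most like the `ρ`-th power of the unshifted one, as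
long as `ρ` dominates the ratio of the two hazard rates. -/
lemma gaussTail_sub_ge_rpow {m ρ T t : ℝ} (hT : 0 < T) (hTt : T ≤ t)
    (hρ : ∀ x ∈ Set.Icc T t, max (x - m) 0 + 1 ≤ ρ * x) :
    gaussTail (T - m) * (gaussTail t / gaussTail T) ^ ρ ≤ gaussTail (t - m) := by
  set D : ℝ → ℝ := fun x => Real.log (gaussTail (x - m)) - ρ * Real.log (gaussTail x) with hD
  have hder : ∀ x, HasDerivAt D (-(gaussDensity (x - m) / gaussTail (x - m)) +
      ρ * (gaussDensity x / gaussTail x)) x := fun x => by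
    have h1 := ((hasDerivAt_gaussTail (x - m)).comp x ((hasDerivAt_id x).sub_const m)).log
      (gaussTail_pos (x - m)).ne'
    have h2 := ((hasDerivAt_gaussTail x).log (gaussTail_pos _).ne').const_mul ρ
    refine (h1.sub h2).congr_deriv ?_
    simp only [Function.comp, id]
    ring
  have key : D T ≤ D t := by
    refine monotoneOn_of_deriv_nonneg (convex_Icc T t)
      (fun x _ => (hder x).continuousAt.continuousWithinAt)
      (fun x _ => (hder x).differentiableAt.differentiableWithinAt) ?_
      ⟨le_rfl, hTt⟩ ⟨hTt, le_rfl⟩ hTt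
    rw [interior_Icc]
    intro x hx
    rw [(hder x).deriv]
    have hx0 : 0 < x := hT.trans hx.1
    have h1 : gaussDensity (x - m) / gaussTail (x - m) ≤ max (x - m) 0 + 1 :=
      (div_le_iff₀ (gaussTail_pos _)).2 (gaussDensity_le_max_mul _)
    have h2 : x ≤ gaussDensity x / gaussTail x := by
      rw [le_div_iff₀ (gaussTail_pos _), mul_comm, ← le_div_iff₀ hx0]
      exact gaussTail_le_div hx0
    have h3 := hρ x ⟨hx.1.le, hx.2.le⟩
    have hρ0 : 0 ≤ ρ := by
      by_contra hneg
      nlinarith [le_max_right (x - m) 0]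
    have h4 := mul_le_mul_of_nonneg_left h2 hρ0
    linarith
  have hpos : 0 < gaussTail t / gaussTail T := div_pos (gaussTail_pos _) (gaussTail_pos _)
  rw [← Real.log_le_log_iff (mul_pos (gaussTail_pos _) (Real.rpow_pos_of_pos hpos _))
    (gaussTail_pos _), Real.log_mul (gaussTail_pos _).ne' (Real.rpow_pos_of_pos hpos _).ne',
    Real.log_rpow hpos, Real.log_div (gaussTail_pos _).ne' (gaussTail_pos _).ne']
  simp only [hD] at key
  linarith

/-! ### The mean exceedance function and the mean discovery number -/

section MeanExceed

variable {qn : ℝ} {n : ℕ} {μ : Fin n → ℝ}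

/-- The slope of the mean exceedance function at `k`. -/
noncomputable def meanSlope (qn : ℝ) {n : ℕ} (μ : Fin n → ℝ) (k : ℝ) : ℝ :=
  qn / n * ∑ l, likelihoodRatio (μ l) (threshold qn n k)

lemma meanExceed_le_card (qn : ℝ) (μ : Fin n → ℝ) (k : ℝ) : meanExceed qn μ k ≤ n := by
  unfold meanExceed
  simpa using Finset.sum_le_card_nsmul Finset.univ
    (fun l => (gaussianReal (μ l) 1).real {x : ℝ | threshold qn n k ≤ |x|}) 1
    fun _ _ => measureReal_le_one

lemma meanExceed_eq (h0 : 0 < qn) (h1 : qn < 1) {k : ℝ} (hk : 0 < k) (hkn : k ≤ n) :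
    meanExceed qn μ k = ∑ l, exceedProb (μ l) (threshold qn n k) :=
  Finset.sum_congr rfl fun _ _ => measureReal_le_abs _ (threshold_pos h0 h1 hk hkn)

lemma meanExceed_mono (h0 : 0 < qn) (h1 : qn < 1) {k k' : ℝ} (hk : 0 < k)
    (hkk : k ≤ k') (hkn : k' ≤ n) :
    meanExceed qn μ k ≤ meanExceed qn μ k' := by
  rw [meanExceed_eq h0 h1 hk (hkk.trans hkn), meanExceed_eq h0 h1 (hk.trans_le hkk) hkn]
  exact Finset.sum_le_sum fun l _ => exceedProb_antitone _ (threshold_anti h0 h1 hk hkk hkn)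

lemma meanSlope_anti (h0 : 0 < qn) (h1 : qn < 1) {k k' : ℝ} (hk : 0 < k)
    (hkk : k ≤ k') (hkn : k' ≤ n) :
    meanSlope qn μ k' ≤ meanSlope qn μ k := by
  unfold meanSlope
  refine mul_le_mul_of_nonneg_left (Finset.sum_le_sum fun l _ => ?_) (by positivity)
  exact likelihoodRatio_mono _ (threshold_pos h0 h1 (hk.trans_le hkk) hkn).le
    (threshold_anti h0 h1 hk hkk hkn)

/-- The mean exceedance function is concave. -/
lemma meanExceed_le_tangent (h0 : 0 < qn) (h1 : qn < 1) {k k' : ℝ} (hk : 0 < k)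
    (hkn : k ≤ n) (hk' : 0 < k') (hkn' : k' ≤ n) :
    meanExceed qn μ k ≤ meanExceed qn μ k' + meanSlope qn μ k' * (k - k') := by
  rw [meanExceed_eq h0 h1 hk hkn, meanExceed_eq h0 h1 hk' hkn', meanSlope]
  have h := fun l => exceedProb_le_tangent (μ l) (threshold_pos h0 h1 hk hkn).le
    (threshold_pos h0 h1 hk' hkn').le
  rw [gaussTail_threshold h0 h1 hk hkn, gaussTail_threshold h0 h1 hk' hkn'] at h
  refine (Finset.sum_le_sum fun l _ => h l).trans (le_of_eq ?_)
  rw [Finset.sum_add_distrib, ← Finset.sum_mul]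
  ring

lemma meanSlope_mul_le (h0 : 0 < qn) (h1 : qn < 1) {k : ℝ} (hk : 0 < k) (hkn : k ≤ n) :
    meanSlope qn μ k * k ≤ meanExceed qn μ k := by
  rw [meanExceed_eq h0 h1 hk hkn, meanSlope]
  have h := fun l => likelihoodRatio_mul_le (μ l) (threshold_pos h0 h1 hk hkn).le
  rw [gaussTail_threshold h0 h1 hk hkn] at h
  refine le_trans (le_of_eq ?_) (Finset.sum_le_sum fun l _ => h l)
  rw [← Finset.sum_mul]
  ring

/-- `M(k) / k` is nonincreasing. -/
lemma meanExceed_mul_le (h0 : 0 < qn) (h1 : qn < 1) {k k' : ℝ} (hk : 0 < k)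
    (hkk : k ≤ k') (hkn : k' ≤ n) :
    meanExceed qn μ k' * k ≤ meanExceed qn μ k * k' := by
  have a := meanExceed_le_tangent h0 h1 (μ := μ) (hk.trans_le hkk) hkn hk (hkk.trans hkn)
  have b := meanSlope_mul_le h0 h1 (μ := μ) hk (hkk.trans hkn)
  have c := mul_le_mul_of_nonneg_right a hk.le
  have d := mul_le_mul_of_nonneg_right b (sub_nonneg.2 hkk)
  nlinarith

lemma continuousOn_meanExceed (h0 : 0 < qn) (h1 : qn < 1) {a : ℝ} (ha : 0 < a) :
    ContinuousOn (meanExceed qn μ) (Set.Icc a n) := by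
  have hK : (0 : ℝ) ≤ n / a := by positivity
  refine (LipschitzOnWith.of_le_add_mul (Real.toNNReal (n / a)) fun x hx y hy => ?_).continuousOn
  have hx0 : 0 < x := ha.trans_le hx.1
  have hy0 : 0 < y := ha.trans_le hy.1
  rw [Real.coe_toNNReal _ hK]
  rcases le_total x y with h | h
  · have := meanExceed_mono h0 h1 (μ := μ) hx0 h hy.2
    have : 0 ≤ (n : ℝ) / a * dist x y := by positivity
    linarith
  · have e := meanExceed_mul_le h0 h1 (μ := μ) hy0 h hx.2
    have c := meanExceed_le_card qn μ y
    rw [Real.dist_eq, abs_of_nonneg (sub_nonneg.2 h)]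
    have e2 : (meanExceed qn μ x - meanExceed qn μ y) * y ≤ n * (x - y) := by
      nlinarith [mul_le_mul_of_nonneg_right c (sub_nonneg.2 h)]
    have e3 : meanExceed qn μ x - meanExceed qn μ y ≤ n * (x - y) / y :=
      (le_div_iff₀ hy0).2 e2
    have e4 : n * (x - y) / y ≤ n * (x - y) / a := by
      have : 0 ≤ (n : ℝ) * (x - y) := mul_nonneg (by positivity) (sub_nonneg.2 h)
      gcongr
      exact hy.1
    have e5 : n / a * (x - y) = n * (x - y) / a := by ring
    linarith

lemma meanDiscovery_nonneg (qn : ℝ) (μ : Fin n → ℝ) : 0 ≤ meanDiscovery qn μ :=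
  Real.sInf_nonneg fun _ hx => hx.1.le

lemma bddBelow_discovery (qn : ℝ) (μ : Fin n → ℝ) :
    BddBelow {k : ℝ | 0 < k ∧ meanExceed qn μ k = k} := ⟨0, fun _ hx => hx.1.le⟩

lemma meanExceed_le_of_meanDiscovery_le (h0 : 0 < qn) (h1 : qn < 1) {k : ℝ} (hk : 0 < k)
    (hkn : k ≤ n)
    (hle : meanDiscovery qn μ ≤ k) : meanExceed qn μ k ≤ k := by
  by_contra! hcon
  obtain ⟨r, hr, hr0⟩ := intermediate_value_Icc' hkn
    ((continuousOn_meanExceed h0 h1 (μ := μ) hk).sub continuousOn_id)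
    (show (0 : ℝ) ∈ Set.Icc _ _ from
      ⟨by simpa using meanExceed_le_card qn μ n, by simpa using hcon.le⟩)
  have hne : {k : ℝ | 0 < k ∧ meanExceed qn μ k = k}.Nonempty :=
    ⟨r, hk.trans_le hr.1, by simpa [sub_eq_zero] using hr0⟩
  -- every fixed point dominates `M(k)`, so `M(k) ≤ k(μ) ≤ k`
  have : meanExceed qn μ k ≤ meanDiscovery qn μ := by
    refine le_csInf hne ?_
    rintro s ⟨hs0, hs⟩
    have hsn : s ≤ n := hs ▸ meanExceed_le_card qn μ s
    rcases le_total s k with h | h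
    · have := meanExceed_mul_le h0 h1 (μ := μ) hs0 h hkn
      rw [hs, mul_comm s k] at this
      exact absurd (le_of_mul_le_mul_right this hs0) (not_le.2 hcon)
    · have := meanExceed_mono h0 h1 (μ := μ) hk h hsn
      linarith
  linarith

lemma le_meanExceed_meanDiscovery (h0 : 0 < qn) (h1 : qn < 1) (hpos : 0 < meanDiscovery qn μ) :
    meanDiscovery qn μ ≤ n ∧ meanDiscovery qn μ ≤ meanExceed qn μ (meanDiscovery qn μ) := by
  have hne : {k : ℝ | 0 < k ∧ meanExceed qn μ k = k}.Nonempty := by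
    by_contra hcon
    rw [Set.not_nonempty_iff_eq_empty] at hcon
    rw [meanDiscovery, hcon, Real.sInf_empty] at hpos
    exact lt_irrefl _ hpos
  obtain ⟨s, hs0, hs⟩ := hne
  have hsn : s ≤ n := hs ▸ meanExceed_le_card qn μ s
  have hle : meanDiscovery qn μ ≤ s := csInf_le (bddBelow_discovery qn μ) ⟨hs0, hs⟩
  refine ⟨hle.trans hsn, ?_⟩
  have := meanExceed_mul_le h0 h1 (μ := μ) hpos hle hsn
  rw [hs, mul_comm] at this
  exact le_of_mul_le_mul_right this hs0

end MeanExceed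

/-! ### The mean exceedances of a sparse mean vector -/

/-- The sparsity shared by the three parameter spaces, in terms of `ε = η`, `p = 0` for `ℓ_0` and
of `ε = η ^ p` for `ℓ_p` and `m_p`: at most `n ε s⁻ᵖ` coordinates exceed `s` in absolute value. -/
def IsSparse {n : ℕ} (ε p : ℝ) (μ : Fin n → ℝ) : Prop :=
  ∀ s : ℝ, 0 < s → ((Finset.univ.filter fun l => s < |μ l|).card : ℝ) ≤ n * ε * s ^ (-p)

/-- A common bound, for `|m| ≤ 4 T / 5`, on the likelihood ratio at `T` and on the ratio of power
to level of the test with cut-off `T`. -/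
noncomputable def smallRatio (T m : ℝ) : ℝ :=
  Real.exp (T * |m| - m ^ 2 / 2) * ((T + 1) / (T - |m|))

/-- A bound on the average of `smallRatio` over the means of size at most `4 T / 5`. The first
term comes from the means of size at most `1 / T ^ 2`, the second from the others. -/
noncomputable def smallRatioBound (T ε : ℝ) : ℝ :=
  Real.exp (1 / T) * ((T + 1) / (T - 1 / T ^ 2)) + 10 * ε * T ^ 4 * Real.exp (12 / 25 * T ^ 2)

section SmallMeans

variable {T m : ℝ}

lemma likelihoodRatio_le_smallRatio (hT : 0 < T) (hm : |m| ≤ 4 / 5 * T) :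
    likelihoodRatio m T ≤ smallRatio T m := by
  refine (likelihoodRatio_le m hT.le).trans ?_
  unfold smallRatio
  refine le_mul_of_one_le_right (Real.exp_pos _).le ?_
  rw [one_le_div (by linarith)]
  linarith [abs_nonneg m]

lemma exceedProb_le_smallRatio (hT : 0 < T) (hm : |m| ≤ 4 / 5 * T) :
    exceedProb m T ≤ 2 * gaussTail T * smallRatio T m := by
  have hpos : 0 < T - |m| := by linarith
  have e1 : gaussDensity (T - |m|) = gaussDensity T * Real.exp (T * |m| - m ^ 2 / 2) := by
    have : -(T - |m|) ^ 2 / 2 = -T ^ 2 / 2 + (T * |m| - m ^ 2 / 2) := by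
      rw [← sq_abs m]; ring
    simp only [gaussDensity, this, Real.exp_add]
    ring
  have e2 : gaussTail (T - |m|) ≤ (T + 1) * gaussTail T * Real.exp (T * |m| - m ^ 2 / 2) /
      (T - |m|) := by
    refine (gaussTail_le_div hpos).trans ?_
    rw [e1]
    have := gaussDensity_le_mul hT.le
    gcongr
  refine (exceedProb_le m T).trans ?_
  refine (mul_le_mul_of_nonneg_left e2 (by norm_num)).trans (le_of_eq ?_)
  unfold smallRatio
  ring

lemma smallRatio_le_near (hT : 2 ≤ T) (hm : |m| ≤ 1 / T ^ 2) :
    smallRatio T m ≤ Real.exp (1 / T) * ((T + 1) / (T - 1 / T ^ 2)) := by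
  have h1 : 1 / T ^ 2 ≤ 1 / 4 := by
    apply one_div_le_one_div_of_le (by norm_num); nlinarith
  have h2 : T * |m| ≤ 1 / T := by
    have e : T * (1 / T ^ 2) = 1 / T := by field_simp
    rw [← e]; gcongr
  have h3 : 0 < T - 1 / T ^ 2 := by linarith
  have h4 : 0 ≤ (T + 1) / (T - |m|) := div_nonneg (by linarith) (by linarith)
  unfold smallRatio
  gcongr
  nlinarith [sq_nonneg m]

lemma smallRatio_le_mid (hT : 2 ≤ T) (hm : |m| ≤ 4 / 5 * T) :
    smallRatio T m ≤ 10 * Real.exp (12 / 25 * T ^ 2) := by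
  have h1 : T * |m| - m ^ 2 / 2 ≤ 12 / 25 * T ^ 2 := by
    rw [← sq_abs m]
    nlinarith [mul_nonneg (sub_nonneg.2 hm) (show 0 ≤ T - (4 / 5 * T + |m|) / 2 by linarith)]
  have h2 : (T + 1) / (T - |m|) ≤ 10 := by
    rw [div_le_iff₀ (by linarith)]
    linarith
  have h3 : 0 ≤ (T + 1) / (T - |m|) := div_nonneg (by linarith) (by linarith)
  unfold smallRatio
  rw [mul_comm (10 : ℝ)]
  exact mul_le_mul (Real.exp_le_exp.2 h1) h2 h3 (Real.exp_pos _).le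

lemma sum_smallRatio_le {n : ℕ} {ε p : ℝ} {μ : Fin n → ℝ} (hT : 2 ≤ T) (hε : 0 ≤ ε) (hp : p ≤ 2)
    (hμ : IsSparse ε p μ) :
    ∑ l ∈ Finset.univ.filter (fun l => |μ l| ≤ 4 / 5 * T), smallRatio T (μ l) ≤
      n * smallRatioBound T ε := by
  set near := Real.exp (1 / T) * ((T + 1) / (T - 1 / T ^ 2)) with hnear
  set mid := 10 * Real.exp (12 / 25 * T ^ 2) with hmid
  have hmid0 : 0 ≤ mid := by positivity
  have hs0 : 0 < 1 / T ^ 2 := by positivity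
  have hs1 : 1 / T ^ 2 ≤ 1 := by rw [div_le_one (by positivity)]; nlinarith
  have hnear0 : 0 ≤ near :=
    mul_nonneg (Real.exp_pos _).le (div_nonneg (by linarith) (by linarith))
  have hcount : ((Finset.univ.filter fun l => 1 / T ^ 2 < |μ l|).card : ℝ) ≤ n * ε * T ^ 4 := by
    refine (hμ _ hs0).trans ?_
    have : (1 / T ^ 2) ^ (-p) ≤ T ^ 4 := by
      calc (1 / T ^ 2) ^ (-p) ≤ (1 / T ^ 2) ^ (-2 : ℝ) :=
            Real.rpow_le_rpow_of_exponent_ge hs0 hs1 (by linarith)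
        _ = T ^ 4 := by
            rw [Real.rpow_neg hs0.le, Real.rpow_two]
            field_simp
    gcongr
  calc ∑ l ∈ Finset.univ.filter (fun l => |μ l| ≤ 4 / 5 * T), smallRatio T (μ l)
      ≤ ∑ l ∈ Finset.univ.filter (fun l => |μ l| ≤ 4 / 5 * T),
          (near + if 1 / T ^ 2 < |μ l| then mid else 0) := by
        refine Finset.sum_le_sum fun l hl => ?_
        have hl' := (Finset.mem_filter.1 hl).2
        split_ifs with h
        · linarith [smallRatio_le_mid hT hl']
        · linarith [smallRatio_le_near hT (not_lt.1 h)]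
    _ ≤ ∑ l : Fin n, (near + if 1 / T ^ 2 < |μ l| then mid else 0) := by
        refine Finset.sum_le_sum_of_subset_of_nonneg (Finset.filter_subset _ _) fun l _ _ => ?_
        split_ifs <;> linarith
    _ = n * near + (Finset.univ.filter fun l => 1 / T ^ 2 < |μ l|).card * mid := by
        rw [Finset.sum_add_distrib, ← Finset.sum_filter]
        simp
    _ ≤ n * near + n * ε * T ^ 4 * mid := by gcongr
    _ = n * smallRatioBound T ε := by rw [smallRatioBound, hnear, hmid]; ring

end SmallMeans

/-- The conditions on the numerical parameters under which the mean exceedance function is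
controlled from the point `w = α_n k_n` on, where `k_n = n ε τ⁻ᵖ`. -/
structure Regime (n : ℕ) (qn q ε p τ w : ℝ) : Prop where
  qn_pos : 0 < qn
  qn_lt_one : qn < 1
  q_nonneg : 0 ≤ q
  q_lt_one : q < 1
  eps_pos : 0 < ε
  p_nonneg : 0 ≤ p
  p_le_two : p ≤ 2
  tau_pos : 0 < τ
  w_eq : w = alpha q τ * (n * ε * τ ^ (-p))
  two_le_w : 2 ≤ w
  w_le : w ≤ n * ε * τ ^ (-p)
  le_card : n * ε * τ ^ (-p) ≤ n
  two_le_threshold : 2 ≤ threshold qn n w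
  tau_le_threshold : 9 / 10 * τ ≤ threshold qn n w
  small : qn * smallRatioBound (threshold qn n w) ε ≤ q + (1 - q) / 20

namespace Regime

variable {n : ℕ} {qn q ε p τ w : ℝ} {μ : Fin n → ℝ}

lemma w_pos (h : Regime n qn q ε p τ w) : 0 < w := by linarith [h.two_le_w]

lemma w_le_card (h : Regime n qn q ε p τ w) : w ≤ n := h.w_le.trans h.le_card

lemma card_pos (h : Regime n qn q ε p τ w) : (0 : ℝ) < n := h.w_pos.trans_le h.w_le_card

/-- Few means exceed `4 t_w / 5`; the constant is `(25 / 18) ^ 2`, rounded up, as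
`4 t_w / 5 ≥ 18 τ / 25` and `p ≤ 2`. -/
lemma card_large_le (h : Regime n qn q ε p τ w) (hμ : IsSparse ε p μ) :
    ((Finset.univ.filter fun l => ¬ |μ l| ≤ 4 / 5 * threshold qn n w).card : ℝ) ≤
      193 / 100 * (n * ε * τ ^ (-p)) := by
  have hτ := h.tau_pos
  have hn := h.card_pos
  have hε := h.eps_pos
  have hT := h.tau_le_threshold
  simp only [not_le]
  refine (hμ _ (by linarith)).trans ?_
  have e1 : (4 / 5 * threshold qn n w) ^ (-p) ≤ (18 / 25 * τ) ^ (-p) :=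
    Real.rpow_le_rpow_of_nonpos (by linarith) (by linarith) (by linarith [h.p_nonneg])
  have e2 : (18 / 25 : ℝ) ^ (-p) ≤ 193 / 100 := by
    calc (18 / 25 : ℝ) ^ (-p) ≤ (18 / 25 : ℝ) ^ (-2 : ℝ) :=
          Real.rpow_le_rpow_of_exponent_ge (by norm_num) (by norm_num) (by linarith [h.p_le_two])
      _ ≤ 193 / 100 := by
          rw [Real.rpow_neg (by norm_num), Real.rpow_two]; norm_num
  rw [Real.mul_rpow (by norm_num) hτ.le] at e1
  have hτp : 0 < τ ^ (-p) := Real.rpow_pos_of_pos hτ _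
  have e3 := mul_le_mul_of_nonneg_right e2 hτp.le
  calc n * ε * (4 / 5 * threshold qn n w) ^ (-p) ≤ n * ε * (193 / 100 * τ ^ (-p)) := by
        gcongr; linarith
    _ = _ := by ring

/-- The mean exceedance function has slope at most `(1 + q) / 2 < 1` at `w`, hence beyond `w`. -/
lemma meanSlope_le (h : Regime n qn q ε p τ w) (hμ : IsSparse ε p μ) :
    meanSlope qn μ w ≤ (1 + q) / 2 := by
  have hq := h.q_lt_one
  have hn := h.card_pos
  have hw := h.w_pos
  have hτ := h.tau_pos
  have hT2 := h.two_le_threshold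
  have hTτ := h.tau_le_threshold
  have hκ : 0 < n * ε * τ ^ (-p) := hw.trans_le h.w_le
  have hsmall := h.small
  have hB := h.card_large_le hμ
  have hgt := gaussTail_threshold h.qn_pos h.qn_lt_one hw h.w_le_card
  have hweq := h.w_eq
  have hqn := h.qn_pos
  set T := threshold qn n w with hT
  set κ := n * ε * τ ^ (-p) with hκdef
  have hsum : ∑ l, likelihoodRatio (μ l) T ≤
      n * smallRatioBound T ε + 193 / 100 * κ * Real.exp (T ^ 2 / 2) := by
    rw [← Finset.sum_filter_add_sum_filter_not Finset.univ (fun l => |μ l| ≤ 4 / 5 * T)]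
    refine add_le_add ?_ ?_
    · refine le_trans (Finset.sum_le_sum fun l hl => ?_)
        (sum_smallRatio_le hT2 h.eps_pos.le h.p_le_two hμ)
      exact likelihoodRatio_le_smallRatio (by linarith) (Finset.mem_filter.1 hl).2
    · refine le_trans (Finset.sum_le_card_nsmul _ _ (Real.exp (T ^ 2 / 2)) fun l _ => ?_) ?_
      · refine (likelihoodRatio_le _ (by linarith)).trans (Real.exp_le_exp.2 ?_)
        rw [← sq_abs (μ l)]
        nlinarith [sq_nonneg (T - |μ l|)]
      · rw [nsmul_eq_mul]
        gcongr
  -- at the point `w`, the level per coordinate is `2 * gaussTail T`, at most `2 φ(T) / T`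
  have hlevel : qn / n * Real.exp (T ^ 2 / 2) ≤ 4 / 5 / (T * w) := by
    have e1 : qn / n = 2 * gaussTail T / w := by rw [hgt]; field_simp
    have e2 : gaussTail T * Real.exp (T ^ 2 / 2) ≤ 2 / 5 / T := by
      have a := gaussTail_le_div (x := T) (by linarith)
      rw [gaussDensity_eq_zero_mul] at a
      calc gaussTail T * Real.exp (T ^ 2 / 2)
          ≤ gaussDensity 0 * Real.exp (-T ^ 2 / 2) / T * Real.exp (T ^ 2 / 2) := by gcongr
        _ = gaussDensity 0 / T * (Real.exp (-T ^ 2 / 2) * Real.exp (T ^ 2 / 2)) := by ring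
        _ = gaussDensity 0 / T := by
            rw [← Real.exp_add, show -T ^ 2 / 2 + T ^ 2 / 2 = 0 by ring, Real.exp_zero, mul_one]
        _ ≤ 2 / 5 / T := by
            have := gaussDensity_zero_le
            gcongr
    rw [e1]
    calc 2 * gaussTail T / w * Real.exp (T ^ 2 / 2)
        = 2 * (gaussTail T * Real.exp (T ^ 2 / 2)) / w := by ring
      _ ≤ 2 * (2 / 5 / T) / w := by gcongr
      _ = _ := by field_simp; norm_num
  have hκw : κ / w = (1 - q) / 4 * τ := by
    rw [hweq, alpha]
    have : (1 - q) ≠ 0 := by linarith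
    field_simp
  have hτT : τ / T ≤ 10 / 9 := by rw [div_le_iff₀ (by linarith)]; linarith
  calc meanSlope qn μ w
      ≤ qn / n * (n * smallRatioBound T ε + 193 / 100 * κ * Real.exp (T ^ 2 / 2)) := by
        unfold meanSlope; gcongr
    _ = qn * smallRatioBound T ε + 193 / 100 * κ * (qn / n * Real.exp (T ^ 2 / 2)) := by
        field_simp
    _ ≤ q + (1 - q) / 20 + 193 / 100 * κ * (4 / 5 / (T * w)) := by gcongr
    _ = q + (1 - q) / 20 + 193 / 100 * (4 / 5) * (κ / w) / T := by field_simp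
    _ = q + (1 - q) / 20 + 193 / 500 * (1 - q) * (τ / T) := by rw [hκw]; ring
    _ ≤ q + (1 - q) / 20 + 193 / 500 * (1 - q) * (10 / 9) := by
        have : 0 ≤ 193 / 500 * (1 - q) := by linarith
        gcongr
    _ ≤ (1 + q) / 2 := by linarith

lemma sum_small_exceedProb_le (h : Regime n qn q ε p τ w) (hμ : IsSparse ε p μ) :
    ∑ l ∈ Finset.univ.filter (fun l => |μ l| ≤ 4 / 5 * threshold qn n w),
      exceedProb (μ l) (threshold qn n w) ≤ (q + (1 - q) / 20) * w := by
  have hn := h.card_pos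
  have hw := h.w_pos
  have hT2 := h.two_le_threshold
  have hsmall := h.small
  have hgt := gaussTail_threshold h.qn_pos h.qn_lt_one hw h.w_le_card
  set T := threshold qn n w with hT
  calc _ ≤ ∑ l ∈ Finset.univ.filter (fun l => |μ l| ≤ 4 / 5 * T),
        2 * gaussTail T * smallRatio T (μ l) := Finset.sum_le_sum fun l hl =>
          exceedProb_le_smallRatio (by linarith) (Finset.mem_filter.1 hl).2
    _ ≤ 2 * gaussTail T * (n * smallRatioBound T ε) := by
        rw [← Finset.mul_sum]
        exact mul_le_mul_of_nonneg_left (sum_smallRatio_le hT2 h.eps_pos.le h.p_le_two hμ)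
          (by linarith [gaussTail_pos T])
    _ = qn * smallRatioBound T ε * w := by rw [hgt]; field_simp
    _ ≤ _ := by gcongr

lemma meanExceed_le (h : Regime n qn q ε p τ w) (hμ : IsSparse ε p μ) :
    meanExceed qn μ w ≤ 3 * (n * ε * τ ^ (-p)) := by
  have hq := h.q_lt_one
  have hw := h.w_pos
  rw [meanExceed_eq h.qn_pos h.qn_lt_one hw h.w_le_card,
    ← Finset.sum_filter_add_sum_filter_not Finset.univ
      (fun l => |μ l| ≤ 4 / 5 * threshold qn n w)]
  have a := h.sum_small_exceedProb_le hμ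
  have b := h.card_large_le hμ
  have c : ∑ l ∈ Finset.univ.filter (fun l => ¬ |μ l| ≤ 4 / 5 * threshold qn n w),
      exceedProb (μ l) (threshold qn n w) ≤
      (Finset.univ.filter fun l => ¬ |μ l| ≤ 4 / 5 * threshold qn n w).card := by
    simpa using Finset.sum_le_card_nsmul
      (Finset.univ.filter fun l => ¬ |μ l| ≤ 4 / 5 * threshold qn n w)
      (fun l => exceedProb (μ l) (threshold qn n w)) 1 fun l _ => by
        rw [← measureReal_le_abs _ (threshold_pos h.qn_pos h.qn_lt_one hw h.w_le_card)]
        exact measureReal_le_one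
  have d : (q + (1 - q) / 20) * w ≤ w := by nlinarith
  linarith [h.w_le]

lemma meanDiscovery_le (h : Regime n qn q ε p τ w) (hμ : IsSparse ε p μ) :
    (1 - q) * meanDiscovery qn μ ≤ 6 * (n * ε * τ ^ (-p)) := by
  have hq := h.q_lt_one
  have hq0 := h.q_nonneg
  have hw := h.w_pos
  rcases le_total (meanDiscovery qn μ) w with hle | hle
  · have := meanDiscovery_nonneg qn μ
    nlinarith [h.w_le]
  · obtain ⟨a, b⟩ := le_meanExceed_meanDiscovery h.qn_pos h.qn_lt_one (hw.trans_le hle)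
    have c := meanExceed_le_tangent h.qn_pos h.qn_lt_one (μ := μ) (hw.trans_le hle) a hw
      h.w_le_card
    have d := mul_le_mul_of_nonneg_right (h.meanSlope_le hμ) (sub_nonneg.2 hle)
    have e := h.meanExceed_le hμ
    nlinarith

/-- If `M(w) ≥ w`, then a fixed share of the exceedances at `w` comes from means of the order of
`t_w`, and these decay slowly as `k` decreases to `1`. -/
lemma rpow_le_meanExceed_one (h : Regime n qn q ε p τ w) (hμ : IsSparse ε p μ)
    (hM : w ≤ meanExceed qn μ w) :
    (1 - q) / 4 * w ^ (4 / 5 * (threshold qn n w / threshold qn n 1) - 1 / threshold qn n w) ≤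
      meanExceed qn μ 1 := by
  have hq := h.q_lt_one
  have hw := h.w_pos
  have hn := h.card_pos
  have hw1 : 1 ≤ w := by linarith [h.two_le_w]
  have hn1 : (1 : ℝ) ≤ n := hw1.trans h.w_le_card
  have hT2 := h.two_le_threshold
  have hTt := threshold_anti h.qn_pos h.qn_lt_one one_pos hw1 h.w_le_card
  have hsmall := h.sum_small_exceedProb_le hμ
  have hgT := gaussTail_threshold h.qn_pos h.qn_lt_one hw h.w_le_card
  have hgt := gaussTail_threshold h.qn_pos h.qn_lt_one one_pos hn1
  have hqn := h.qn_pos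
  rw [meanExceed_eq h.qn_pos h.qn_lt_one hw h.w_le_card,
    ← Finset.sum_filter_add_sum_filter_not Finset.univ
      (fun l => |μ l| ≤ 4 / 5 * threshold qn n w)] at hM
  rw [meanExceed_eq h.qn_pos h.qn_lt_one one_pos hn1]
  set T := threshold qn n w
  set t := threshold qn n 1
  set ρ := 1 - (4 / 5 * (T / t) - 1 / T) with hρ
  have ht : 0 < t := by linarith
  have hT : 0 < T := by linarith
  have hratio : gaussTail t / gaussTail T = w⁻¹ := by
    rw [hgT, hgt]; field_simp
  have hbig : ∀ l, ¬ |μ l| ≤ 4 / 5 * T →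
      1 / 2 * exceedProb (μ l) T * w⁻¹ ^ ρ ≤ exceedProb (μ l) t := by
    intro l hl
    rw [not_le] at hl
    refine le_trans ?_ (gaussTail_le_exceedProb _ _)
    have := gaussTail_sub_ge_rpow (m := |μ l|) (ρ := ρ) hT hTt fun x hx => by
      have a : max (x - |μ l|) 0 ≤ x - 4 / 5 * T := max_le (by linarith) (by linarith [hx.1])
      have b : T / t * x ≤ T := by
        rw [div_mul_eq_mul_div, div_le_iff₀ ht]
        exact mul_le_mul_of_nonneg_left hx.2 hT.le
      have c : 1 ≤ 1 / T * x := by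
        rw [one_div_mul_eq_div, one_le_div hT]; exact hx.1
      have : ρ * x = x - 4 / 5 * (T / t * x) + 1 / T * x := by rw [hρ]; ring
      linarith
    rw [hratio] at this
    refine le_trans ?_ this
    have := exceedProb_le (μ l) T
    gcongr
    linarith
  have hpow : w * w⁻¹ ^ ρ = w ^ (4 / 5 * (T / t) - 1 / T) := by
    rw [Real.inv_rpow hw.le, ← Real.rpow_neg hw.le]
    nth_rewrite 1 [← Real.rpow_one w]
    rw [← Real.rpow_add hw, hρ]
    congr 1; ring
  have hpos : 0 < w⁻¹ ^ ρ := Real.rpow_pos_of_pos (inv_pos.2 hw) _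
  rw [← hpow]
  calc (1 - q) / 4 * (w * w⁻¹ ^ ρ) = 1 / 2 * ((1 - q) / 2 * w) * w⁻¹ ^ ρ := by ring
    _ ≤ 1 / 2 * (∑ l ∈ Finset.univ.filter (fun l => ¬ |μ l| ≤ 4 / 5 * T), exceedProb (μ l) T) *
          w⁻¹ ^ ρ := by
        gcongr
        nlinarith
    _ = ∑ l ∈ Finset.univ.filter (fun l => ¬ |μ l| ≤ 4 / 5 * T),
          1 / 2 * exceedProb (μ l) T * w⁻¹ ^ ρ := by
        rw [Finset.mul_sum, Finset.sum_mul]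
    _ ≤ ∑ l ∈ Finset.univ.filter (fun l => ¬ |μ l| ≤ 4 / 5 * T), exceedProb (μ l) t :=
        Finset.sum_le_sum fun l hl => hbig l (Finset.mem_filter.1 hl).2
    _ ≤ ∑ l, exceedProb (μ l) t :=
        Finset.sum_le_sum_of_subset_of_nonneg (Finset.filter_subset _ _) fun l _ _ =>
          (gaussTail_pos _).le.trans (gaussTail_le_exceedProb _ _)

end Regime

/-! ### The sandwich for sparse means -/

instance isProbabilityMeasure_normalLaw {n : ℕ} (μ : Fin n → ℝ) :
    IsProbabilityMeasure (normalLaw μ) := by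
  unfold normalLaw; infer_instance

lemma kPlus_sub_kMinus_le (qn : ℝ) {n : ℕ} (μ : Fin n → ℝ) {w : ℝ} (hw : 0 ≤ w) :
    kPlus qn w μ - kMinus qn w μ ≤ 3 * w := by
  unfold kPlus kMinus
  split_ifs with hc
  · rw [max_eq_left (by linarith)]; linarith
  · have : max (meanDiscovery qn μ) w ≤ 2 * w := max_le (by linarith) (by linarith)
    linarith

section Deviations

variable {n : ℕ} {qn : ℝ} {μ : Fin n → ℝ}

lemma measure_card_exceed_ge_le {k : ℝ} (hk : 0 < k) (hM : meanExceed qn μ k ≤ k) :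
    (normalLaw μ).real
        {y | k ≤ ((Finset.univ.filter fun l => threshold qn n k ≤ |y l|).card : ℝ)} ≤
      Real.exp (-((k - meanExceed qn μ k) ^ 2 / (4 * k))) :=
  measure_card_ge_le (fun i => gaussianReal (μ i) 1) (A := {x | threshold qn n k ≤ |x|})
    (measurableSet_le measurable_const measurable_norm) hk hM

lemma measure_card_exceed_le_le {k : ℝ} (hk : 0 < k) (hM : k ≤ meanExceed qn μ k) :
    (normalLaw μ).real
        {y | ((Finset.univ.filter fun l => threshold qn n k < |y l|).card : ℝ) ≤ k} ≤
      Real.exp (-((meanExceed qn μ k - k) ^ 2 / (4 * meanExceed qn μ k))) := by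
  have h : ∑ l, (gaussianReal (μ l) 1).real {x | threshold qn n k < |x|} =
      meanExceed qn μ k := Finset.sum_congr rfl fun l _ => measureReal_lt_abs _ _
  have := measure_card_le_le (fun i => gaussianReal (μ i) 1) (A := {x | threshold qn n k < |x|})
    (measurableSet_lt measurable_const measurable_norm) hk.le (h ▸ hM) (h ▸ hk.trans_le hM)
  rw [h] at this
  exact this

/-- Monotonicity of the Chernoff exponent in the gap. -/
lemma sq_div_add_le {a b g : ℝ} (hg : 0 < g) (hga : g ≤ a) (hb : 0 ≤ b) :
    g ^ 2 / (4 * (b + g)) ≤ a ^ 2 / (4 * (b + a)) := by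
  have ha : 0 < a := hg.trans_le hga
  rw [div_le_div_iff₀ (by linarith) (by linarith)]
  have h1 : g ^ 2 ≤ a ^ 2 := by gcongr
  nlinarith [mul_le_mul_of_nonneg_right h1 hb, mul_nonneg (mul_pos ha hg).le (sub_nonneg.2 hga)]

end Deviations

namespace Regime

variable {n : ℕ} {qn q ε p τ w E : ℝ} {μ : Fin n → ℝ}

/-- Beyond the upper bracket, the number of exceedances is unlikely to reach `k`. -/
lemma upper_deviation (h : Regime n qn q ε p τ w) (hμ : IsSparse ε p μ)
    (hE : E ≤ (1 - q) ^ 3 * w ^ 2 / (448 * (n * ε * τ ^ (-p)))) {k : ℝ} (hkn : k ≤ n)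
    (hk : kPlus qn w μ < k) :
    (normalLaw μ).real
        {y | k ≤ ((Finset.univ.filter fun l => threshold qn n k ≤ |y l|).card : ℝ)} ≤
      Real.exp (-E) := by
  have hq := h.q_lt_one
  have hq0 := h.q_nonneg
  have hw := h.w_pos
  have hwκ := h.w_le
  have hk0 := meanDiscovery_nonneg qn μ
  have hdisc := h.meanDiscovery_le hμ
  have hslope := h.meanSlope_le hμ
  set κ := n * ε * τ ^ (-p)
  unfold kPlus at hk
  set m := max (meanDiscovery qn μ) w with hm
  have hmw : w ≤ m := le_max_right _ _
  have hm0 : 0 < m := hw.trans_le hmw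
  have hmn : m ≤ n := by linarith
  have hκ : 0 < κ := hw.trans_le hwκ
  have hMm : meanExceed qn μ m ≤ m :=
    meanExceed_le_of_meanDiscovery_le h.qn_pos h.qn_lt_one hm0 hmn (le_max_left _ _)
  have hs : meanSlope qn μ m ≤ (1 + q) / 2 :=
    (meanSlope_anti h.qn_pos h.qn_lt_one hw hmw hmn).trans hslope
  have htan := meanExceed_le_tangent h.qn_pos h.qn_lt_one (μ := μ) (k := k) (by linarith) hkn
    hm0 hmn
  have hgap : (1 - q) / 2 * (k - m) ≤ k - meanExceed qn μ k := by
    have := mul_le_mul_of_nonneg_right hs (show 0 ≤ k - m by linarith)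
    linarith
  have hgap0 : 0 ≤ (1 - q) / 2 * (k - m) := mul_nonneg (by linarith) (by linarith)
  refine (measure_card_exceed_ge_le (by linarith) (by linarith)).trans
    (Real.exp_le_exp.2 (neg_le_neg ?_))
  have hmκ : (1 - q) * (m + w) ≤ 7 * κ := by
    have h1 : (1 - q) * w ≤ κ := by nlinarith
    rcases max_choice (meanDiscovery qn μ) w with hc | hc
    · rw [hm, hc]; nlinarith
    · rw [hm, hc]; nlinarith
  calc E ≤ (1 - q) ^ 3 * w ^ 2 / (448 * κ) := hE
    _ ≤ (1 - q) ^ 3 * w ^ 2 / (112 * κ) := by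
        have : 0 ≤ (1 - q) ^ 3 * w ^ 2 := by
          have : 0 ≤ 1 - q := by linarith
          positivity
        gcongr
        norm_num
    _ ≤ ((1 - q) / 2) ^ 2 * (w ^ 2 / (4 * (m + w))) := by
        rw [← mul_div_assoc, div_le_div_iff₀ (by linarith) (by linarith)]
        have : 0 ≤ (1 - q) ^ 2 * w ^ 2 := by positivity
        nlinarith [mul_le_mul_of_nonneg_left hmκ this]
    _ ≤ ((1 - q) / 2) ^ 2 * ((k - m) ^ 2 / (4 * (m + (k - m)))) := by
        gcongr ?_ * ?_
        exact sq_div_add_le hw (by linarith) hm0.le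
    _ = ((1 - q) / 2 * (k - m)) ^ 2 / (4 * k) := by ring
    _ ≤ _ := by
        have : 0 < k := by linarith
        gcongr

/-- Up to the lower bracket, the number of exceedances is likely to be larger than `k`. -/
lemma lower_deviation (h : Regime n qn q ε p τ w) (hμ : IsSparse ε p μ)
    (hE : E ≤ (1 - q) ^ 3 * w ^ 2 / (448 * (n * ε * τ ^ (-p))))
    (hE' : E ≤ (1 - q) ^ 3 / 144 *
      w ^ (4 / 5 * (threshold qn n w / threshold qn n 1) - 1 / threshold qn n w))
    {k : ℝ} (hk1 : 1 ≤ k) (hk : k < kMinus qn w μ + 1) :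
    (normalLaw μ).real
        {y | ((Finset.univ.filter fun l => threshold qn n k < |y l|).card : ℝ) ≤ k} ≤
      Real.exp (-E) := by
  have hq := h.q_lt_one
  have hq0 := h.q_nonneg
  have hw := h.w_pos
  have hw2 := h.two_le_w
  have hwκ := h.w_le
  have hdisc := h.meanDiscovery_le hμ
  have hslope := h.meanSlope_le hμ
  unfold kMinus at hk
  split_ifs at hk with hcase
  swap
  · linarith
  set κ := n * ε * τ ^ (-p)
  set k₀ := meanDiscovery qn μ
  have hk0 : 0 < k₀ := by linarith
  have hκ : 0 < κ := hw.trans_le hwκ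
  obtain ⟨hk0n, hMk0⟩ := le_meanExceed_meanDiscovery h.qn_pos h.qn_lt_one hk0
  -- the slope bound beyond `w` turns `M(k₀) ≥ k₀` into a lower bound for `M`
  have hlow : ∀ j, w ≤ j → j ≤ k₀ → j + (1 - q) / 2 * (k₀ - j) ≤ meanExceed qn μ j := by
    intro j hwj hj
    have hs : meanSlope qn μ j ≤ (1 + q) / 2 :=
      (meanSlope_anti h.qn_pos h.qn_lt_one hw hwj (hj.trans hk0n)).trans hslope
    have htan := meanExceed_le_tangent h.qn_pos h.qn_lt_one (μ := μ) hk0 hk0n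
      (hw.trans_le hwj) (hj.trans hk0n)
    have := mul_le_mul_of_nonneg_right hs (sub_nonneg.2 hj)
    linarith
  have hkpos : 0 < k := by linarith
  rcases le_total w k with hwk | hkw
  · have hM := hlow k hwk (by linarith)
    have hgap : (1 - q) / 4 * w ≤ meanExceed qn μ k - k := by nlinarith
    have hg0 : 0 < (1 - q) / 4 * w := by
      have : 0 < 1 - q := by linarith
      positivity
    refine (measure_card_exceed_le_le hkpos (by linarith)).trans
      (Real.exp_le_exp.2 (neg_le_neg ?_))
    have hle : k + (1 - q) / 4 * w ≤ k₀ := by nlinarith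
    calc E ≤ (1 - q) ^ 3 * w ^ 2 / (448 * κ) := hE
      _ ≤ ((1 - q) / 4 * w) ^ 2 / (4 * (k + (1 - q) / 4 * w)) := by
          rw [div_le_div_iff₀ (by linarith) (by linarith)]
          have a : 0 ≤ (1 - q) ^ 2 * w ^ 2 := by positivity
          have b : (1 - q) * (k + (1 - q) / 4 * w) ≤ 6 * κ :=
            (mul_le_mul_of_nonneg_left hle (by linarith)).trans hdisc
          have c : (1 - q) ^ 3 * w ^ 2 * (4 * (k + (1 - q) / 4 * w)) =
              4 * ((1 - q) ^ 2 * w ^ 2 * ((1 - q) * (k + (1 - q) / 4 * w))) := by ring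
          have d : ((1 - q) / 4 * w) ^ 2 * (448 * κ) = 28 * ((1 - q) ^ 2 * w ^ 2 * κ) := by ring
          have e := mul_le_mul_of_nonneg_left b a
          have f : 0 ≤ (1 - q) ^ 2 * w ^ 2 * κ := by positivity
          rw [c, d]
          linarith
      _ ≤ (meanExceed qn μ k - k) ^ 2 / (4 * (k + (meanExceed qn μ k - k))) :=
          sq_div_add_le hg0 hgap hkpos.le
      _ = _ := by rw [add_sub_cancel]
  · have hMw := hlow w le_rfl (by linarith)
    have hone := h.rpow_le_meanExceed_one hμ (by nlinarith)
    have hmono := meanExceed_mono h.qn_pos h.qn_lt_one (μ := μ) one_pos hk1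
      (hkw.trans h.w_le_card)
    have hrat := meanExceed_mul_le h.qn_pos h.qn_lt_one (μ := μ) hkpos hkw h.w_le_card
    have hM : (1 + (1 - q) / 2) * k ≤ meanExceed qn μ k := by
      have a : (1 + (1 - q) / 2) * w ≤ meanExceed qn μ w := by nlinarith
      have b := mul_le_mul_of_nonneg_right a hkpos.le
      have c : (1 + (1 - q) / 2) * k * w ≤ meanExceed qn μ k * w := by linarith
      exact le_of_mul_le_mul_right c hw
    set M := meanExceed qn μ k
    have hMpos : 0 < M := by nlinarith
    have hgap : M * ((1 - q) / 3) ≤ M - k := by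
      have a := mul_le_mul_of_nonneg_right hM (show 0 ≤ 1 - (1 - q) / 3 by linarith)
      have b : k ≤ (1 + (1 - q) / 2) * k * (1 - (1 - q) / 3) := by
        have : (1 + (1 - q) / 2) * k * (1 - (1 - q) / 3) = k + k * ((1 - q) * q) / 6 := by ring
        have : 0 ≤ k * ((1 - q) * q) := mul_nonneg hkpos.le (mul_nonneg (by linarith) hq0)
        linarith
      linarith
    refine (measure_card_exceed_le_le hkpos (by nlinarith)).trans
      (Real.exp_le_exp.2 (neg_le_neg ?_))
    calc E ≤ (1 - q) ^ 2 / 36 * ((1 - q) / 4 *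
          w ^ (4 / 5 * (threshold qn n w / threshold qn n 1) - 1 / threshold qn n w)) := by
          refine hE'.trans (le_of_eq ?_); ring
      _ ≤ (1 - q) ^ 2 / 36 * M := by
          gcongr
          exact hone.trans hmono
      _ = (M * ((1 - q) / 3)) ^ 2 / (4 * M) := by field_simp; ring
      _ ≤ _ := by
          have : 0 ≤ M * ((1 - q) / 3) := mul_nonneg hMpos.le (by linarith)
          gcongr

/-- A union bound over `k` of the two deviation bounds. -/
lemma measure_compl_sandwichEvent_le (h : Regime n qn q ε p τ w) (hμ : IsSparse ε p μ)
    (hE : E ≤ (1 - q) ^ 3 * w ^ 2 / (448 * (n * ε * τ ^ (-p))))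
    (hE' : E ≤ (1 - q) ^ 3 / 144 *
      w ^ (4 / 5 * (threshold qn n w / threshold qn n 1) - 1 / threshold qn n w)) :
    (normalLaw μ).real (sandwichEvent qn w μ)ᶜ ≤ 2 * n * Real.exp (-E) := by
  have hw := h.w_pos
  set U : ℕ → Set (Fin n → ℝ) := fun k => {y | kPlus qn w μ < k ∧
    k ≤ (Finset.univ.filter fun l => threshold qn n k ≤ |y l|).card} with hU
  set V : ℕ → Set (Fin n → ℝ) := fun k => {y | (k : ℝ) < kMinus qn w μ + 1 ∧
    (Finset.univ.filter fun l => threshold qn n k < |y l|).card ≤ k} with hV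
  have hkPlus : 0 ≤ kPlus qn w μ :=
    add_nonneg ((meanDiscovery_nonneg qn μ).trans (le_max_left _ _)) hw.le
  have hkMinus : kMinus qn w μ ≤ n := by
    unfold kMinus
    split_ifs with hc
    · have := (le_meanExceed_meanDiscovery h.qn_pos h.qn_lt_one (μ := μ) (by linarith)).1
      linarith
    · positivity
  have hsub : (sandwichEvent qn w μ)ᶜ ⊆ ⋃ k ∈ Finset.Icc 1 n, (U k ∪ V k) := by
    intro y hy
    by_contra hcon
    simp only [Set.mem_iUnion, not_exists, Set.mem_union, not_or, Finset.mem_Icc] at hcon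
    refine hy ?_
    have hF : (kF qn y : ℝ) ≤ kPlus qn w μ := by
      by_contra! hlt
      have hpos : 0 < kF qn y := by exact_mod_cast hkPlus.trans_lt hlt
      obtain ⟨a, b⟩ := kF_le_card hpos
      exact (hcon _ ⟨hpos, a⟩).1 ⟨hlt, b⟩
    have hG : kMinus qn w μ ≤ kG qn y := by
      by_contra! hlt
      have hn : kG qn y < n := by exact_mod_cast hlt.trans_le hkMinus
      have := card_le_kG h.qn_pos h.qn_lt_one hn
      exact (hcon (kG qn y + 1) ⟨by omega, hn⟩).2 ⟨by push_cast; linarith, by omega⟩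
    exact ⟨hG, kG_le_kF qn y, hF, by linarith [kPlus_sub_kMinus_le qn μ hw.le]⟩
  have hUle : ∀ k ∈ Finset.Icc 1 n, (normalLaw μ).real (U k) ≤ Real.exp (-E) := by
    intro k hk
    have hkn : (k : ℝ) ≤ n := by exact_mod_cast (Finset.mem_Icc.1 hk).2
    by_cases hc : kPlus qn w μ < k
    · refine le_trans (measureReal_mono fun y hy => ?_) (h.upper_deviation hμ hE hkn hc)
      exact_mod_cast hy.2
    · have : U k = ∅ := Set.eq_empty_of_forall_notMem fun y hy => hc hy.1
      rw [this, measureReal_empty]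
      exact (Real.exp_pos _).le
  have hVle : ∀ k ∈ Finset.Icc 1 n, (normalLaw μ).real (V k) ≤ Real.exp (-E) := by
    intro k hk
    have hk1 : (1 : ℝ) ≤ k := by exact_mod_cast (Finset.mem_Icc.1 hk).1
    by_cases hc : (k : ℝ) < kMinus qn w μ + 1
    · refine le_trans (measureReal_mono fun y hy => ?_) (h.lower_deviation hμ hE hE' hk1 hc)
      exact_mod_cast hy.2
    · have : V k = ∅ := Set.eq_empty_of_forall_notMem fun y hy => hc hy.1
      rw [this, measureReal_empty]
      exact (Real.exp_pos _).le
  calc (normalLaw μ).real (sandwichEvent qn w μ)ᶜ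
      ≤ (normalLaw μ).real (⋃ k ∈ Finset.Icc 1 n, (U k ∪ V k)) :=
        measureReal_mono hsub (measure_ne_top _ _)
    _ ≤ ∑ k ∈ Finset.Icc 1 n, (normalLaw μ).real (U k ∪ V k) :=
        measureReal_biUnion_finset_le _ _
    _ ≤ ∑ k ∈ Finset.Icc 1 n, (Real.exp (-E) + Real.exp (-E)) :=
        Finset.sum_le_sum fun k hk =>
          (measureReal_union_le _ _).trans (add_le_add (hUle k hk) (hVle k hk))
    _ = 2 * n * Real.exp (-E) := by
        simp; ring

end Regime

/-! ### Large samples -/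

lemma gaussTail_le_exp {x : ℝ} (hx : 1 ≤ x) : gaussTail x ≤ Real.exp (-x ^ 2 / 2) := by
  refine (gaussTail_le_div (by linarith)).trans ?_
  refine (div_le_self (gaussDensity_pos x).le hx).trans ?_
  rw [gaussDensity_eq_zero_mul]
  exact mul_le_of_le_one_left (Real.exp_pos _).le (gaussDensity_zero_le.trans (by norm_num))

/-- The order `k_n = n ε τ⁻ᵖ` of the number of discoveries. -/
noncomputable def discoveryScale (n : ℕ) (ε p : ℝ) : ℝ := n * ε * tau ε ^ (-p)

/-- The half-width `α_n k_n` of the brackets. -/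
noncomputable def bandwidth (n : ℕ) (q ε p : ℝ) : ℝ := alpha q (tau ε) * discoveryScale n ε p

/-- The relations between the sample size `n = exp L`, the sparsity `ε = exp (-ℓ)` and the false
discovery rate from which the sandwich is derived; the constants `b` and `c` do not depend
on `n`. -/
structure SparseScale (n : ℕ) (qn q ε p b c L ℓ : ℝ) : Prop where
  q_nonneg : 0 ≤ q
  q_lt_one : q < 1
  b_pos : 0 < b
  c_pos : 0 < c
  c_le_one : c ≤ 1
  p_nonneg : 0 ≤ p
  p_le_two : p ≤ 2
  card_eq : (n : ℝ) = Real.exp L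
  eps_eq : ε = Real.exp (-ℓ)
  le_eps : L ^ 5 ≤ n * ε
  le_rate : c / L ≤ qn
  rate_lt_one : qn < 1
  one_le : 1 ≤ L
  le_ell : b * L ≤ ℓ
  four_le_tau : 4 ≤ (1 - q) * tau ε

namespace SparseScale

variable {n : ℕ} {qn q ε p b c L ℓ : ℝ}

lemma qn_pos (h : SparseScale n qn q ε p b c L ℓ) : 0 < qn :=
  (div_pos h.c_pos (one_pos.trans_le h.one_le)).trans_le h.le_rate

lemma ell_pos (h : SparseScale n qn q ε p b c L ℓ) : 0 < ℓ :=
  (mul_pos h.b_pos (one_pos.trans_le h.one_le)).trans_le h.le_ell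

lemma ell_le (h : SparseScale n qn q ε p b c L ℓ) : ℓ ≤ L := by
  have h1 : 1 ≤ n * ε := (one_le_pow₀ h.one_le).trans h.le_eps
  rw [h.card_eq, h.eps_eq, ← Real.exp_add, Real.one_le_exp_iff] at h1
  linarith

lemma eps_pos (h : SparseScale n qn q ε p b c L ℓ) : 0 < ε := by
  rw [h.eps_eq]; exact Real.exp_pos _

lemma eps_le_one (h : SparseScale n qn q ε p b c L ℓ) : ε ≤ 1 := by
  rw [h.eps_eq, Real.exp_le_one_iff]; linarith [h.ell_pos]

lemma card_pos (h : SparseScale n qn q ε p b c L ℓ) : (0 : ℝ) < n := by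
  rw [h.card_eq]; exact Real.exp_pos _

lemma tau_sq (h : SparseScale n qn q ε p b c L ℓ) : tau ε ^ 2 = 2 * ℓ := by
  rw [tau, h.eps_eq, ← Real.exp_neg, neg_neg, Real.log_exp, Real.sq_sqrt]
  linarith [h.ell_pos]

lemma four_le (h : SparseScale n qn q ε p b c L ℓ) : 4 ≤ tau ε := by
  have := h.four_le_tau
  have h0 : 0 ≤ tau ε := Real.sqrt_nonneg _
  nlinarith [h.q_nonneg]

lemma tau_rpow_le (h : SparseScale n qn q ε p b c L ℓ) : tau ε ^ (-p) ≤ 1 :=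
  Real.rpow_le_one_of_one_le_of_nonpos (by linarith [h.four_le]) (by linarith [h.p_nonneg])

lemma le_tau_rpow (h : SparseScale n qn q ε p b c L ℓ) : (2 * L)⁻¹ ≤ tau ε ^ (-p) := by
  have h4 := h.four_le
  calc (2 * L)⁻¹ ≤ (tau ε ^ 2)⁻¹ := by
        rw [h.tau_sq]
        have := h.ell_pos
        have := h.ell_le
        gcongr
    _ = tau ε ^ (-2 : ℝ) := by rw [Real.rpow_neg (by linarith), Real.rpow_two]
    _ ≤ tau ε ^ (-p) :=
        Real.rpow_le_rpow_of_exponent_le (by linarith) (by linarith [h.p_le_two])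

lemma scale_pos (h : SparseScale n qn q ε p b c L ℓ) : 0 < discoveryScale n ε p :=
  mul_pos (mul_pos h.card_pos h.eps_pos) (Real.rpow_pos_of_pos (by linarith [h.four_le]) _)

lemma scale_le (h : SparseScale n qn q ε p b c L ℓ) : discoveryScale n ε p ≤ n := by
  have h1 := h.card_pos
  have h2 := mul_le_mul_of_nonneg_left h.eps_le_one h1.le
  have h3 : 0 ≤ n * ε := mul_nonneg h1.le h.eps_pos.le
  have h4 := mul_le_mul_of_nonneg_left h.tau_rpow_le h3
  unfold discoveryScale
  linarith

lemma le_scale (h : SparseScale n qn q ε p b c L ℓ) :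
    n * ε ≤ 2 * L * discoveryScale n ε p := by
  have hL : 0 < 2 * L := by linarith [h.one_le]
  have h3 : 0 ≤ n * ε := mul_nonneg h.card_pos.le h.eps_pos.le
  have h4 := mul_le_mul_of_nonneg_left h.le_tau_rpow h3
  have h5 := mul_le_mul_of_nonneg_left h4 hL.le
  unfold discoveryScale
  calc n * ε = 2 * L * (n * ε * (2 * L)⁻¹) := by
        rw [mul_comm (2 * L), mul_assoc, inv_mul_cancel₀ hL.ne', mul_one]
    _ ≤ _ := h5

lemma bandwidth_mul (h : SparseScale n qn q ε p b c L ℓ) :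
    bandwidth n q ε p * ((1 - q) * tau ε) = 4 * discoveryScale n ε p := by
  have h1 : 1 - q ≠ 0 := by linarith [h.q_lt_one]
  have h2 : tau ε ≠ 0 := by linarith [h.four_le]
  rw [bandwidth, alpha]
  field_simp

lemma bandwidth_pos (h : SparseScale n qn q ε p b c L ℓ) : 0 < bandwidth n q ε p := by
  have h1 := h.bandwidth_mul
  have h2 := h.scale_pos
  have h3 := h.four_le_tau
  by_contra! hneg
  nlinarith

lemma bandwidth_le (h : SparseScale n qn q ε p b c L ℓ) :
    bandwidth n q ε p ≤ discoveryScale n ε p := by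
  have h1 := h.bandwidth_mul
  have h2 := h.bandwidth_pos
  nlinarith [h.four_le_tau]

lemma scale_le_bandwidth (h : SparseScale n qn q ε p b c L ℓ) :
    4 * discoveryScale n ε p ≤ bandwidth n q ε p * tau ε := by
  rw [← h.bandwidth_mul]
  have := h.bandwidth_pos
  have h4 := h.four_le
  gcongr
  exact mul_le_of_le_one_left (by linarith) (by linarith [h.q_nonneg])

lemma le_bandwidth_sq (h : SparseScale n qn q ε p b c L ℓ) :
    (n * ε) ^ 2 ≤ bandwidth n q ε p ^ 2 * L ^ 3 := by
  have h1 := h.scale_le_bandwidth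
  have h2 := h.le_scale
  have hL := h.one_le
  have h3 : 0 ≤ n * ε := mul_nonneg h.card_pos.le h.eps_pos.le
  have h4 : 2 * (n * ε) ≤ L * (bandwidth n q ε p * tau ε) := by nlinarith
  have h5 : (2 * (n * ε)) ^ 2 ≤ (L * (bandwidth n q ε p * tau ε)) ^ 2 := by gcongr
  have h6 : (L * (bandwidth n q ε p * tau ε)) ^ 2 =
      2 * (L ^ 2 * bandwidth n q ε p ^ 2) * ℓ := by
    rw [mul_pow, mul_pow, h.tau_sq]; ring
  have h7 : 2 * (L ^ 2 * bandwidth n q ε p ^ 2) * ℓ ≤ 2 * (L ^ 2 * bandwidth n q ε p ^ 2) * L := by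
    gcongr
    exact h.ell_le
  nlinarith [sq_nonneg (n * ε)]

lemma le_log_bandwidth (h : SparseScale n qn q ε p b c L ℓ) :
    L - ℓ - 3 / 2 * Real.log L ≤ Real.log (bandwidth n q ε p) := by
  have h1 := h.le_bandwidth_sq
  have hL : 0 < L := by linarith [h.one_le]
  have hw := h.bandwidth_pos
  rw [h.card_eq, h.eps_eq, ← Real.exp_add] at h1
  have h2 := Real.log_le_log (by positivity) h1
  rw [Real.log_mul (by rw [h.eps_eq] at hw; positivity) (by positivity), Real.log_pow, Real.log_pow,
    Real.log_pow, Real.log_exp, ← h.eps_eq] at h2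
  push_cast at h2
  linarith

lemma seven_half_log_le (h : SparseScale n qn q ε p b c L ℓ) :
    7 / 2 * Real.log L ≤ Real.log (bandwidth n q ε p) := by
  have hL : 0 < L := by linarith [h.one_le]
  have h1 : (L ^ 5) ^ 2 ≤ (n * ε) ^ 2 := by
    have := h.le_eps
    gcongr
  have h2 := Real.log_le_log (by positivity) (h1.trans h.le_bandwidth_sq)
  have hw := h.bandwidth_pos
  rw [Real.log_mul (by positivity) (by positivity), Real.log_pow, Real.log_pow,
    Real.log_pow, Real.log_pow] at h2
  push_cast at h2
  linarith

lemma two_le_bandwidth (h : SparseScale n qn q ε p b c L ℓ) (hL : 2 ≤ L) :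
    2 ≤ bandwidth n q ε p := by
  have h1 := h.seven_half_log_le
  have h0 : 0 ≤ Real.log L := Real.log_nonneg h.one_le
  have h2 : Real.log L ≤ Real.log (bandwidth n q ε p) := by linarith
  have := (Real.log_le_log_iff (by linarith) h.bandwidth_pos).1 h2
  linarith

lemma bandwidth_le_card (h : SparseScale n qn q ε p b c L ℓ) : bandwidth n q ε p ≤ n :=
  h.bandwidth_le.trans h.scale_le

lemma gaussTail_eq (h : SparseScale n qn q ε p b c L ℓ) :
    gaussTail (threshold qn n (bandwidth n q ε p)) * ((1 - q) * tau ε) =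
      2 * qn * (ε * tau ε ^ (-p)) := by
  have hn := h.card_pos
  rw [gaussTail_threshold h.qn_pos h.rate_lt_one h.bandwidth_pos h.bandwidth_le_card]
  have h1 := h.bandwidth_mul
  unfold discoveryScale at h1
  calc _ = qn / 2 / n * (bandwidth n q ε p * ((1 - q) * tau ε)) := by ring
    _ = _ := by rw [h1]; field_simp; norm_num

/-- The level at `t_w` is at most of the order of `ε / τ`, whereas the tail at `9 τ / 10` is of the
order of `ε ^ (81 / 100) / τ`. -/
lemma tau_le_threshold (h : SparseScale n qn q ε p b c L ℓ)
    (hb : Real.log (12 / (1 - q)) ≤ 19 / 100 * (b * L)) :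
    9 / 10 * tau ε ≤ threshold qn n (bandwidth n q ε p) := by
  rw [← gaussTail_strictAnti.le_iff_ge]
  have h4 := h.four_le
  have hq : 0 < 1 - q := by linarith [h.q_lt_one]
  have h1 : gaussTail (threshold qn n (bandwidth n q ε p)) * ((1 - q) * tau ε) ≤ 2 * ε := by
    rw [h.gaussTail_eq]
    have a : ε * tau ε ^ (-p) ≤ ε := mul_le_of_le_one_right h.eps_pos.le h.tau_rpow_le
    have b : 0 ≤ ε * tau ε ^ (-p) := mul_nonneg h.eps_pos.le (by positivity)
    nlinarith [h.rate_lt_one, h.qn_pos]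
  have h2 : 12 * ε ≤ (1 - q) * Real.exp (-(81 / 100) * ℓ) := by
    have a : 12 / (1 - q) ≤ Real.exp (19 / 100 * ℓ) := by
      rw [← Real.log_le_iff_le_exp (by positivity)]
      linarith [h.le_ell]
    rw [div_le_iff₀ hq] at a
    have b : Real.exp (-(81 / 100) * ℓ) = Real.exp (19 / 100 * ℓ) * ε := by
      rw [h.eps_eq, ← Real.exp_add]; congr 1; ring
    rw [b]
    have := mul_le_mul_of_nonneg_right a h.eps_pos.le
    linarith
  have h3 : Real.exp (-(81 / 100) * ℓ) ≤ 6 * tau ε * gaussTail (9 / 10 * tau ε) := by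
    have a := gaussDensity_le_mul (x := 9 / 10 * tau ε) (by linarith)
    have e : -(9 / 10 * tau ε) ^ 2 / 2 = -(81 / 100) * ℓ := by
      rw [mul_pow, h.tau_sq]; ring
    rw [gaussDensity_eq_zero_mul, e] at a
    have d := mul_le_mul_of_nonneg_right le_gaussDensity_zero
      (Real.exp_pos (-(81 / 100) * ℓ)).le
    have f := mul_le_mul_of_nonneg_right (show 9 / 10 * tau ε + 1 ≤ 2 * tau ε by linarith)
      (gaussTail_pos (9 / 10 * tau ε)).le
    linarith
  have h5 : 0 < (1 - q) * tau ε := by positivity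
  refine le_of_mul_le_mul_right (h1.trans ?_) h5
  have := mul_le_mul_of_nonneg_left h3 hq.le
  linarith

lemma threshold_sq_le (h : SparseScale n qn q ε p b c L ℓ)
    (hT : 1 ≤ threshold qn n (bandwidth n q ε p)) :
    threshold qn n (bandwidth n q ε p) ^ 2 / 2 ≤ ℓ + 3 * Real.log L + Real.log (2 / c) := by
  have h4 := h.four_le
  have hL := h.one_le
  have hc := h.c_pos
  have hq : 0 < 1 - q := by linarith [h.q_lt_one]
  have hε := h.eps_pos
  set T := threshold qn n (bandwidth n q ε p) with hTdef
  have h1 : c * ε ≤ 2 * L ^ 3 * gaussTail T := by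
    have e := h.gaussTail_eq
    rw [← hTdef] at e
    have a : c / L * (ε * (2 * L)⁻¹) ≤ qn * (ε * tau ε ^ (-p)) := by
      have := h.le_rate
      have := h.le_tau_rpow
      have := h.qn_pos
      gcongr
    have b : (1 - q) * tau ε ≤ 2 * L := by
      have : tau ε ^ 2 ≤ 2 * L := by rw [h.tau_sq]; linarith [h.ell_le]
      have : (1 - q) * tau ε ≤ tau ε :=
        mul_le_of_le_one_left (by linarith) (by linarith [h.q_nonneg])
      nlinarith
    have d := mul_le_mul_of_nonneg_left b (gaussTail_pos T).le
    have f : c / L * (ε * (2 * L)⁻¹) = c * ε / (2 * L ^ 2) := by field_simp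
    rw [f, div_le_iff₀ (by positivity)] at a
    have g : 0 ≤ L ^ 2 := by positivity
    nlinarith [mul_le_mul_of_nonneg_left d g]
  have h2 : c * ε ≤ 2 * L ^ 3 * Real.exp (-T ^ 2 / 2) := by
    refine h1.trans ?_
    have := gaussTail_le_exp hT
    gcongr
  have h3 := Real.log_le_log (by positivity) h2
  rw [Real.log_mul (by positivity) (by positivity), Real.log_mul (by positivity) (by positivity),
    Real.log_mul (by positivity) (by positivity), Real.log_exp, Real.log_pow, h.eps_eq,
    Real.log_exp] at h3
  rw [Real.log_div (by norm_num) (by positivity)]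
  push_cast at h3
  linarith

lemma threshold_one_sq_le (h : SparseScale n qn q ε p b c L ℓ) (ht : 1 ≤ threshold qn n 1) :
    threshold qn n 1 ^ 2 / 2 ≤ L + Real.log L + Real.log (2 / c) := by
  have hL := h.one_le
  have hc := h.c_pos
  have hn := h.card_pos
  have hn1 : (1 : ℝ) ≤ n := by
    rw [h.card_eq, Real.one_le_exp_iff]; linarith
  have e := gaussTail_threshold h.qn_pos h.rate_lt_one one_pos hn1
  have h1 : c / L / 2 * (1 / n) ≤ Real.exp (-threshold qn n 1 ^ 2 / 2) := by
    refine le_trans ?_ (gaussTail_le_exp ht)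
    rw [e]
    have := h.le_rate
    gcongr
  have h3 := Real.log_le_log (by positivity) h1
  rw [Real.log_exp, Real.log_mul (by positivity) (by positivity),
    Real.log_div (by positivity) (by norm_num), Real.log_div (by positivity) (by positivity),
    one_div, Real.log_inv, h.card_eq, Real.log_exp] at h3
  rw [Real.log_div (by norm_num) (by positivity)]
  linarith

/-- The contribution to `smallRatioBound` of the means of intermediate size. -/
lemma mid_le (h : SparseScale n qn q ε p b c L ℓ)
    (hT : 1 ≤ threshold qn n (bandwidth n q ε p)) (hc : Real.log (2 / c) ≤ L) :
    10 * ε * threshold qn n (bandwidth n q ε p) ^ 4 *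
      Real.exp (12 / 25 * threshold qn n (bandwidth n q ε p) ^ 2) ≤
      2000 / c * (L ^ 5 * Real.exp (-(b / 25) * L)) := by
  have h1 := h.threshold_sq_le hT
  have hL := h.one_le
  have hc0 := h.c_pos
  have hlog : Real.log L ≤ L := (Real.log_le_sub_one_of_pos (by linarith)).trans (by linarith)
  have hlog0 : 0 ≤ Real.log L := Real.log_nonneg hL
  have hlogc : 0 ≤ Real.log (2 / c) :=
    Real.log_nonneg (by rw [one_le_div hc0]; linarith [h.c_le_one])
  set T := threshold qn n (bandwidth n q ε p)
  have h2 : T ^ 2 ≤ 10 * L := by linarith [h.ell_le]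
  have h4 : T ^ 4 ≤ 100 * L ^ 2 := by
    calc T ^ 4 = (T ^ 2) ^ 2 := by ring
      _ ≤ (10 * L) ^ 2 := by gcongr
      _ = _ := by ring
  have h5 : ε * Real.exp (12 / 25 * T ^ 2) ≤ 2 / c * (L ^ 3 * Real.exp (-(b / 25) * L)) := by
    have e1 : Real.exp (3 * Real.log L + Real.log (2 / c)) = L ^ 3 * (2 / c) := by
      rw [Real.exp_add, Real.exp_log (by positivity), mul_comm 3, Real.exp_mul,
        Real.exp_log (by linarith)]
      norm_cast
    calc ε * Real.exp (12 / 25 * T ^ 2) = Real.exp (-ℓ + 12 / 25 * T ^ 2) := by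
          rw [h.eps_eq, Real.exp_add]
      _ ≤ Real.exp ((3 * Real.log L + Real.log (2 / c)) + -(b / 25) * L) := by
          apply Real.exp_le_exp.2
          linarith [h.le_ell]
      _ = _ := by rw [Real.exp_add, e1]; ring
  have h6 : 0 ≤ ε * Real.exp (12 / 25 * T ^ 2) := mul_nonneg h.eps_pos.le (Real.exp_pos _).le
  calc 10 * ε * T ^ 4 * Real.exp (12 / 25 * T ^ 2)
      = 10 * (T ^ 4 * (ε * Real.exp (12 / 25 * T ^ 2))) := by ring
    _ ≤ 10 * (100 * L ^ 2 * (2 / c * (L ^ 3 * Real.exp (-(b / 25) * L)))) := by gcongr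
    _ = _ := by ring

/-- The exponent of the deviation bounds at `k ≥ w` is of larger order than `log² n`. -/
lemma le_exponent (h : SparseScale n qn q ε p b c L ℓ) (hL : 448 ≤ (1 - q) ^ 2 * L) :
    2 * L ^ 2 ≤ (1 - q) ^ 3 * bandwidth n q ε p ^ 2 / (448 * discoveryScale n ε p) := by
  have hκ := h.scale_pos
  have hw := h.bandwidth_pos
  have hq : 0 < 1 - q := by linarith [h.q_lt_one]
  have h4 := h.four_le
  have hL1 := h.one_le
  -- `w² / k_n = 16 k_n / ((1 - q)² τ²)`, and `k_n ≥ L⁴ / 2`, `τ² ≤ 2 L`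
  have e : (1 - q) ^ 3 * bandwidth n q ε p ^ 2 / (448 * discoveryScale n ε p) =
      (1 - q) * discoveryScale n ε p / (28 * tau ε ^ 2) := by
    have hw' : bandwidth n q ε p = 4 * discoveryScale n ε p / ((1 - q) * tau ε) := by
      rw [eq_div_iff (by positivity), h.bandwidth_mul]
    rw [hw']
    field_simp
    norm_num
  rw [e, h.tau_sq, le_div_iff₀ (by linarith [h.ell_pos])]
  have h1 : L ^ 5 ≤ 2 * L * discoveryScale n ε p := h.le_eps.trans h.le_scale
  have h2 : L ^ 4 ≤ 2 * discoveryScale n ε p := by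
    have : L * L ^ 4 ≤ L * (2 * discoveryScale n ε p) := by linarith
    exact le_of_mul_le_mul_left this (by linarith)
  have h3 : (1 - q) * L ^ 4 ≤ 2 * ((1 - q) * discoveryScale n ε p) := by nlinarith
  have h5 : 448 ≤ (1 - q) * L := by nlinarith [h.q_nonneg, mul_pos hq (show 0 < L by linarith)]
  have h6 : 448 * L ^ 3 ≤ (1 - q) * L ^ 4 := by
    have := mul_le_mul_of_nonneg_right h5 (show 0 ≤ L ^ 3 by positivity)
    linarith
  have h7 : 2 * L ^ 2 * (28 * (2 * ℓ)) ≤ 2 * L ^ 2 * (28 * (2 * L)) := by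
    have := h.ell_le
    gcongr
  nlinarith [pow_pos (show 0 < L by linarith) 3]

/-- The exponent of the deviation bounds at `k < w` is of larger order than `log² n`. If `ε` is
close to `1 / n`, then `w ≥ log^{7/2} n` and the power of `w` is close to `18 / 25`; otherwise `w`
exceeds a power of `n`, and any positive power of `w` will do. -/
lemma le_exponent' (h : SparseScale n qn q ε p b c L ℓ) {s : ℝ} (hs : 0 < s)
    (hsb : 2 * s ^ 2 ≤ b) (hT50 : 50 ≤ threshold qn n (bandwidth n q ε p))
    (hTs : 1 ≤ 2 / 5 * s * threshold qn n (bandwidth n q ε p))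
    (hTτ : 9 / 10 * tau ε ≤ threshold qn n (bandwidth n q ε p))
    (h1 : Real.log L + Real.log (2 / c) ≤ 1 / 100 * L) (h2 : 30 * Real.log L ≤ L)
    (h3 : Real.log (288 / (1 - q) ^ 3) ≤ 11 / 40 * Real.log L)
    (h4 : 2 * Real.log L + Real.log (288 / (1 - q) ^ 3) ≤ 1 / 50 * s * L) :
    2 * L ^ 2 ≤ (1 - q) ^ 3 / 144 * bandwidth n q ε p ^
      (4 / 5 * (threshold qn n (bandwidth n q ε p) / threshold qn n 1) -
        1 / threshold qn n (bandwidth n q ε p)) := by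
  have hL := h.one_le
  have hq : 0 < 1 - q := by linarith [h.q_lt_one]
  have hw := h.bandwidth_pos
  have hlog0 : 0 ≤ Real.log L := Real.log_nonneg hL
  have hw1 : 1 ≤ bandwidth n q ε p := by
    have := h.seven_half_log_le
    rw [← Real.log_nonneg_iff hw]; linarith
  have hTt := threshold_anti h.qn_pos h.rate_lt_one one_pos hw1 h.bandwidth_le_card
  have ht2 := h.threshold_one_sq_le (by linarith)
  set T := threshold qn n (bandwidth n q ε p)
  set t := threshold qn n 1
  set w := bandwidth n q ε p
  have hT0 : 0 < T := by linarith
  have ht0 : 0 < t := by linarith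
  have hr0 : 0 < T / t := by positivity
  have hr : 81 / 101 * ℓ ≤ (T / t) ^ 2 * L := by
    have a : t ^ 2 ≤ 101 / 50 * L := by linarith
    have b : 81 / 50 * ℓ ≤ T ^ 2 := by
      have : (9 / 10 * tau ε) ^ 2 ≤ T ^ 2 := by
        have := h.four_le
        gcongr
      rw [mul_pow, h.tau_sq] at this
      linarith
    rw [div_pow, div_mul_eq_mul_div (T ^ 2), le_div_iff₀ (by positivity)]
    have d := mul_le_mul_of_nonneg_left a (show 0 ≤ 81 / 101 * ℓ by linarith [h.ell_pos])
    have e := mul_le_mul_of_nonneg_right b (show 0 ≤ L by linarith)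
    linarith
  have key : 2 * Real.log L + Real.log (288 / (1 - q) ^ 3) ≤
      (4 / 5 * (T / t) - 1 / T) * Real.log w := by
    rcases le_total (9 / 10 * L) ℓ with hcase | hcase
    · have a : 21 / 25 ≤ T / t := by
        by_contra! hlt
        have : (T / t) ^ 2 < (21 / 25) ^ 2 := by gcongr
        nlinarith
      have b : 1 / T ≤ 1 / 50 := one_div_le_one_div_of_le (by norm_num) hT50
      have d : 13 / 20 ≤ 4 / 5 * (T / t) - 1 / T := by linarith
      have e := h.seven_half_log_le
      calc _ ≤ 13 / 20 * (7 / 2 * Real.log L) := by linarith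
        _ ≤ _ := mul_le_mul d e (by linarith) (by linarith)
    · have a : s ≤ T / t := by
        by_contra! hlt
        have d : (T / t) ^ 2 < s ^ 2 := by gcongr
        have e := h.le_ell
        have f := mul_le_mul_of_nonneg_right hsb (show 0 ≤ L by linarith)
        have g := mul_lt_mul_of_pos_right d (show 0 < L by linarith)
        nlinarith [sq_nonneg s, mul_pos (pow_pos hs 2) (show 0 < L by linarith)]
      have b : 1 / T ≤ 2 / 5 * s := by rw [div_le_iff₀ hT0]; exact hTs
      have d : 2 / 5 * s ≤ 4 / 5 * (T / t) - 1 / T := by linarith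
      have e : 1 / 20 * L ≤ Real.log w := by linarith [h.le_log_bandwidth]
      calc _ ≤ 2 / 5 * s * (1 / 20 * L) := by linarith
        _ ≤ _ := mul_le_mul d e (by linarith) (by linarith)
  have hexp := Real.exp_le_exp.2 key
  rw [Real.exp_add, Real.exp_log (by positivity), mul_comm (2 : ℝ) (Real.log L), Real.exp_mul,
    Real.exp_log (by linarith), Real.rpow_two, mul_comm _ (Real.log w), Real.exp_mul,
    Real.exp_log hw] at hexp
  have := mul_le_mul_of_nonneg_left hexp (show 0 ≤ (1 - q) ^ 3 / 144 by positivity)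
  refine le_trans (le_of_eq ?_) this
  field_simp
  norm_num

end SparseScale

/-! ### The parameter spaces consist of sparse vectors -/

section Balls

variable {n : ℕ} {μ : Fin n → ℝ} {p η : ℝ}

lemma isSparse_of_mem_l0Ball (hμ : μ ∈ l0Ball n η) : IsSparse η 0 μ := by
  intro s hs
  rw [neg_zero, Real.rpow_zero, mul_one, mul_comm]
  refine le_trans ?_ hμ
  exact_mod_cast Finset.card_le_card fun l hl => by
    simp only [Finset.mem_filter, Finset.mem_univ, true_and] at hl ⊢
    exact abs_pos.1 (hs.trans hl)

lemma isSparse_of_mem_lpBall (hp : 0 < p) (hμ : μ ∈ lpBall n p η) : IsSparse (η ^ p) p μ := by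
  intro s hs
  have hsp : 0 < s ^ p := Real.rpow_pos_of_pos hs _
  rcases Nat.eq_zero_or_pos n with rfl | hn
  · simp
  have hn' : (0 : ℝ) < n := by exact_mod_cast hn
  have hμ' : ∑ i, |μ i| ^ p ≤ n * η ^ p := by
    have : 1 / (n : ℝ) * ∑ i, |μ i| ^ p ≤ η ^ p := hμ
    rwa [one_div, inv_mul_le_iff₀ hn'] at this
  rw [Real.rpow_neg hs.le, ← div_eq_mul_inv, le_div_iff₀ hsp, ← nsmul_eq_mul]
  refine le_trans (Finset.card_nsmul_le_sum _ (fun l => |μ l| ^ p) _ fun l hl => ?_) (le_trans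
    (Finset.sum_le_sum_of_subset_of_nonneg (Finset.filter_subset _ _) fun l _ _ => ?_) hμ')
  · have := (Finset.mem_filter.1 hl).2
    exact Real.rpow_le_rpow hs.le this.le hp.le
  · positivity

lemma isSparse_of_mem_mpBall (hp : 0 < p) (hη : 0 < η) (hμ : μ ∈ mpBall n p η) :
    IsSparse (η ^ p) p μ := by
  intro s hs
  have hsp : 0 < s ^ p := Real.rpow_pos_of_pos hs _
  set m := (Finset.univ.filter fun l => s < |μ l|).card with hm
  rcases Nat.eq_zero_or_pos m with h0 | h0
  · rw [h0, Nat.cast_zero]; positivity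
  have hmn : m ≤ n := by simpa using Finset.card_le_univ (Finset.univ.filter fun l => s < |μ l|)
  have hm0 : (0 : ℝ) < m := by exact_mod_cast h0
  have hlt : s < orderedAbs μ ⟨m - 1, by omega⟩ := by
    by_contra! hle
    have := card_le_of_orderedAbs_le hle
    simp only [← hm] at this
    omega
  have hle := hμ ⟨m - 1, by omega⟩
  simp only [Nat.sub_add_cancel (show 1 ≤ m from h0)] at hle
  have h1 := Real.rpow_le_rpow hs.le (hlt.le.trans hle) hp.le
  rw [Real.mul_rpow (by positivity) (by positivity), Real.mul_rpow hη.le (by positivity),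
    ← Real.rpow_mul (by positivity), ← Real.rpow_mul hm0.le, one_div_mul_cancel hp.ne',
    Real.rpow_one, div_mul_cancel₀ _ hp.ne', Real.rpow_neg_one, ← div_eq_mul_inv,
    le_div_iff₀ hm0] at h1
  rw [Real.rpow_neg hs.le, ← div_eq_mul_inv, le_div_iff₀ hsp]
  linarith

end Balls

/-! ### Uniformity over the sample size -/

lemma tendsto_near : Tendsto (fun T : ℝ => Real.exp (1 / T) * ((T + 1) / (T - 1 / T ^ 2))) atTop
    (𝓝 1) := by
  have h1 : Tendsto (fun T : ℝ => 1 / T) atTop (𝓝 0) := tendsto_const_nhds.div_atTop tendsto_id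
  have h2 : Tendsto (fun T : ℝ => Real.exp (1 / T) * ((1 + 1 / T) / (1 - (1 / T) ^ 3))) atTop
      (𝓝 (Real.exp 0 * ((1 + 0) / (1 - 0 ^ 3)))) :=
    ((Real.continuous_exp.tendsto 0).comp h1).mul
      ((h1.const_add 1).div ((h1.pow 3).const_sub 1) (by norm_num))
  rw [show Real.exp 0 * ((1 + 0) / (1 - 0 ^ 3)) = (1 : ℝ) by simp] at h2
  refine h2.congr' ?_
  filter_upwards [eventually_gt_atTop 0] with T hT
  rw [← mul_div_mul_left (1 + 1 / T) (1 - (1 / T) ^ 3) hT.ne']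
  congr 2
  · field_simp
  · field_simp

lemma eventually_log_add_le {c : ℝ} (hc : 0 < c) (K : ℝ) :
    ∀ᶠ L : ℝ in atTop, Real.log L + K ≤ c * L := by
  filter_upwards [Real.isLittleO_log_id_atTop.def (half_pos hc), eventually_ge_atTop 0,
    eventually_ge_atTop (K / (c / 2))] with L h1 h2 h3
  rw [div_le_iff₀ (half_pos hc)] at h3
  simp only [id, Real.norm_eq_abs, abs_of_nonneg h2] at h1
  linarith [le_abs_self (Real.log L)]

lemma eventually_mul_pow_exp_le {b : ℝ} (hb : 0 < b) (K : ℝ) {δ : ℝ} (hδ : 0 < δ) :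
    ∀ᶠ L : ℝ in atTop, K * (L ^ 5 * Real.exp (-b * L)) ≤ δ := by
  have h := (tendsto_rpow_mul_exp_neg_mul_atTop_nhds_zero 5 b hb).const_mul K
  rw [mul_zero] at h
  filter_upwards [h.eventually_le_const hδ] with L hL
  exact_mod_cast hL

lemma RateAssumption.eventually_ge {qs : ℕ → ℝ} {q b₁ : ℝ} (hQ : RateAssumption qs q b₁)
    (hb₁ : 0 < b₁) : ∃ c : ℝ, 0 < c ∧ c ≤ 1 ∧ ∀ᶠ n : ℕ in atTop, c / Real.log n ≤ qs n := by
  have hlog : Tendsto (fun n : ℕ => Real.log n) atTop atTop :=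
    Real.tendsto_log_atTop.comp tendsto_natCast_atTop_atTop
  rcases hQ.nonneg.eq_or_lt with h | h
  · refine ⟨min b₁ 1, lt_min hb₁ one_pos, min_le_right _ _, ?_⟩
    filter_upwards [eventually_ge_atTop 2, hlog.eventually_ge_atTop 1] with n hn hn1
    refine le_trans ?_ (hQ.lower h.symm n hn)
    gcongr
    exact min_le_left _ _
  · refine ⟨min (q / 2) 1, lt_min (half_pos h) one_pos, min_le_right _ _, ?_⟩
    filter_upwards [hQ.tendsto.eventually_const_le (half_lt_self h),
      hlog.eventually_ge_atTop 1] with n hn hn1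
    exact (div_le_self (lt_min (half_pos h) one_pos).le hn1).trans ((min_le_left _ _).trans hn)

/-- The sandwich event fails with probability at most `2 n exp (-2 log² n)`, uniformly over the
sparse vectors, once `n` is large. -/
lemma eventually_measure_compl_sandwichEvent_le {qs : ℕ → ℝ} {q b₁ b₂ b₃ : ℝ} (hb₁ : 0 < b₁)
    (hb₂ : 0 < b₂) (hb₃ : 0 < b₃) (hQ : RateAssumption qs q b₁) :
    ∀ᶠ n : ℕ in atTop, ∀ ε p : ℝ, 0 < ε → 0 ≤ p → p ≤ 2 → SparsityAssumption b₂ b₃ n ε →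
      ∀ μ : Fin n → ℝ, IsSparse ε p μ →
        (normalLaw μ).real (sandwichEvent (qs n) (bandwidth n q ε p) μ)ᶜ ≤
          2 * n * Real.exp (-(2 * Real.log n ^ 2)) := by
  obtain ⟨c, hc0, hc1, hrate⟩ := hQ.eventually_ge hb₁
  have hq1 := hQ.lt_one
  have hq0 := hQ.nonneg
  have hD : 0 < 1 - q := by linarith
  obtain ⟨b, hb, hbb⟩ : ∃ b : ℝ, 0 < b ∧ b₃ = 2 * b := ⟨b₃ / 2, by positivity, by ring⟩
  obtain ⟨s, hs, hsb⟩ : ∃ s : ℝ, 0 < s ∧ 2 * s ^ 2 ≤ b :=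
    ⟨√(b / 2), by positivity, by rw [Real.sq_sqrt (by positivity)]; linarith⟩
  obtain ⟨T₀, hT₀⟩ := eventually_atTop.1
    ((tendsto_near.eventually_le_const (show (1 : ℝ) < 1 + (1 - q) / 100 by linarith)).and
      ((eventually_ge_atTop (50 : ℝ)).and (eventually_ge_atTop (1 / (2 / 5 * s)))))
  have hlog : Tendsto (fun n : ℕ => Real.log n) atTop atTop :=
    Real.tendsto_log_atTop.comp tendsto_natCast_atTop_atTop
  have hloglog : Tendsto (fun L : ℝ => Real.log L) atTop atTop := Real.tendsto_log_atTop
  filter_upwards [hrate, eventually_gt_atTop 0,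
    hQ.tendsto.eventually_le_const (show q < q + (1 - q) / 100 by linarith),
    hlog.eventually_ge_atTop 2,
    hlog.eventually_ge_atTop (Real.log b₂ / b),
    hlog.eventually_ge_atTop (16 / ((1 - q) ^ 2 * (2 * b))),
    hlog.eventually_ge_atTop (Real.log (12 / (1 - q)) / (19 / 100 * b)),
    hlog.eventually_ge_atTop (T₀ ^ 2 / (81 / 50 * b)),
    hlog.eventually_ge_atTop (Real.log (2 / c)),
    hlog.eventually_ge_atTop (448 / (1 - q) ^ 2),
    hlog.eventually (eventually_mul_pow_exp_le (show 0 < b / 25 by positivity) (2000 / c)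
      (show 0 < (1 - q) / 100 by positivity)),
    hlog.eventually (eventually_log_add_le (show (0 : ℝ) < 1 / 100 by norm_num)
      (Real.log (2 / c))),
    hlog.eventually (eventually_log_add_le (show (0 : ℝ) < 1 / 30 by norm_num) 0),
    hlog.eventually (eventually_log_add_le (show 0 < 1 / 100 * s by positivity)
      (Real.log (288 / (1 - q) ^ 3) / 2)),
    hlog.eventually (hloglog.eventually_ge_atTop (Real.log (288 / (1 - q) ^ 3) / (11 / 40)))]
    with n hrn hn0 hqn hL2 hLb hL16 hL12 hLT hLc hL448 hmid h100 h30 hs100 h288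
    ε p hε hp0 hp2 hsparse μ hμ
  have hn : (0 : ℝ) < n := by exact_mod_cast hn0
  set L := Real.log n with hLdef
  rw [div_le_iff₀ (by positivity)] at hLb hL16 hL12 hLT hL448 h288
  obtain ⟨hs1, hs2⟩ := hsparse
  have hell : b * L ≤ Real.log ε⁻¹ := by
    have h1 := Real.log_le_log hε hs2
    rw [Real.log_mul hb₂.ne' (Real.rpow_pos_of_pos hn _).ne', Real.log_rpow hn, hbb] at h1
    rw [Real.log_inv]
    linarith
  have htau : tau ε ^ 2 = 2 * Real.log ε⁻¹ := by
    rw [tau, Real.sq_sqrt]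
    have : 0 ≤ b * L := by positivity
    linarith
  have htau0 : 0 ≤ tau ε := Real.sqrt_nonneg _
  have h : SparseScale n (qs n) q ε p b c L (Real.log ε⁻¹) :=
    { q_nonneg := hq0
      q_lt_one := hq1
      b_pos := hb
      c_pos := hc0
      c_le_one := hc1
      p_nonneg := hp0
      p_le_two := hp2
      card_eq := (Real.exp_log hn).symm
      eps_eq := by rw [Real.log_inv, neg_neg, Real.exp_log hε]
      le_eps := by rwa [inv_mul_le_iff₀ hn] at hs1
      le_rate := hrn
      rate_lt_one := (hQ.mem n).2
      one_le := by linarith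
      le_ell := hell
      four_le_tau := by
        refine le_of_sq_le_sq ?_ (by positivity)
        rw [mul_pow, htau]
        have := mul_le_mul_of_nonneg_left hell (show 0 ≤ 2 * (1 - q) ^ 2 by positivity)
        linarith }
  have hTτ := h.tau_le_threshold (by linarith)
  have hTT₀ : T₀ ≤ threshold (qs n) n (bandwidth n q ε p) := by
    refine le_trans (le_of_sq_le_sq ?_ (by positivity)) hTτ
    rw [mul_pow, htau]
    linarith
  obtain ⟨hnear, hT50, hTs⟩ := hT₀ _ hTT₀
  rw [div_le_iff₀ (by positivity)] at hTs
  have hmid' := (h.mid_le (by linarith) hLc).trans hmid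
  have hreg : Regime n (qs n) q ε p (tau ε) (bandwidth n q ε p) :=
    { qn_pos := h.qn_pos
      qn_lt_one := h.rate_lt_one
      q_nonneg := hq0
      q_lt_one := hq1
      eps_pos := hε
      p_nonneg := hp0
      p_le_two := hp2
      tau_pos := by linarith [h.four_le]
      w_eq := rfl
      two_le_w := h.two_le_bandwidth hL2
      w_le := h.bandwidth_le
      le_card := h.scale_le
      two_le_threshold := by linarith
      tau_le_threshold := hTτ
      small := by
        have h1 : smallRatioBound (threshold (qs n) n (bandwidth n q ε p)) ε ≤
            1 + (1 - q) / 50 := by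
          unfold smallRatioBound
          linarith
        calc _ ≤ qs n * (1 + (1 - q) / 50) := mul_le_mul_of_nonneg_left h1 h.qn_pos.le
          _ ≤ (q + (1 - q) / 100) * (1 + (1 - q) / 50) := by gcongr
          _ ≤ _ := by nlinarith }
  exact hreg.measure_compl_sandwichEvent_le hμ (h.le_exponent (by linarith))
    (h.le_exponent' hs hsb hT50 (by linarith) hTτ h100 (by linarith) (by linarith) (by linarith))

/-- The finitely many small sample sizes are absorbed in the constant `c₀`. -/
lemma exists_sandwichOn {qs : ℕ → ℝ} {q b₁ b₂ b₃ : ℝ} (hb₁ : 0 < b₁) (hb₂ : 0 < b₂)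
    (hb₃ : 0 < b₃) (hQ : RateAssumption qs q b₁) :
    ∃ c₀ : ℝ, 0 < c₀ ∧ ∀ n : ℕ, 1 ≤ n → ∀ ε p : ℝ, 0 < ε → 0 ≤ p → p ≤ 2 →
      SparsityAssumption b₂ b₃ n ε → ∀ Θ : Set (Fin n → ℝ), (∀ μ ∈ Θ, IsSparse ε p μ) →
        SandwichOn c₀ 1 (qs n) (bandwidth n q ε p) Θ := by
  have hlog : Tendsto (fun n : ℕ => Real.log n) atTop atTop :=
    Real.tendsto_log_atTop.comp tendsto_natCast_atTop_atTop
  obtain ⟨N, hN⟩ := eventually_atTop.1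
    ((eventually_measure_compl_sandwichEvent_le hb₁ hb₂ hb₃ hQ).and (hlog.eventually_ge_atTop 1))
  refine ⟨max 2 (Real.exp (Real.log N ^ 2)), lt_max_of_lt_left two_pos,
    fun n hn ε p hε hp0 hp2 hsp Θ hΘ μ hμ => ⟨kPlus_sub_kMinus_le _ _ ?_, ?_⟩⟩
  · have : 0 ≤ 1 - q := by linarith [hQ.lt_one]
    have : 0 ≤ tau ε := Real.sqrt_nonneg _
    unfold bandwidth alpha discoveryScale
    positivity
  rw [← ofReal_measureReal]
  refine ENNReal.ofReal_le_ofReal ?_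
  rcases le_total N n with hNn | hnN
  · obtain ⟨h1, h2⟩ := hN n hNn
    refine (h1 ε p hε hp0 hp2 hsp μ (hΘ μ hμ)).trans ?_
    have hn0 : (0 : ℝ) < n := by exact_mod_cast hn
    have e : 2 * (n : ℝ) * Real.exp (-(2 * Real.log n ^ 2)) =
        2 * Real.exp (Real.log n - 2 * Real.log n ^ 2) := by
      rw [sub_eq_add_neg, Real.exp_add, Real.exp_log hn0]; ring
    rw [e]
    refine mul_le_mul (le_max_left _ _) (Real.exp_le_exp.2 ?_) (Real.exp_pos _).le
      (two_pos.le.trans (le_max_left _ _))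
    nlinarith
  · refine measureReal_le_one.trans ?_
    have h1 : Real.log n ≤ Real.log N :=
      Real.log_le_log (by exact_mod_cast hn) (by exact_mod_cast hnN)
    have h0 : 0 ≤ Real.log n := Real.log_nonneg (by exact_mod_cast hn)
    calc (1 : ℝ) ≤ Real.exp (Real.log N ^ 2) * Real.exp (-1 * Real.log n ^ 2) := by
          rw [← Real.exp_add, Real.one_le_exp_iff]
          nlinarith
      _ ≤ _ := mul_le_mul_of_nonneg_right (le_max_right _ _) (Real.exp_pos _).le

end FDRSandwich

theorem mainTheorem4 (qs : ℕ → ℝ) (q b₁ b₂ b₃ : ℝ) (hb₁ : 0 < b₁) (hb₂ : 0 < b₂) (hb₃ : 0 < b₃)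
    (hQ : FDRSandwich.RateAssumption qs q b₁) :
    ∃ c₀ c₁ : ℝ, 0 < c₀ ∧ 0 < c₁ ∧ ∀ n : ℕ, 1 ≤ n → ∀ η : ℝ, 0 < η → η < 1 →
      (FDRSandwich.SparsityAssumption b₂ b₃ n η →
        FDRSandwich.SandwichOn c₀ c₁ (qs n)
          (FDRSandwich.alpha q (FDRSandwich.tau η) * (n * η))
          (FDRSandwich.l0Ball n η)) ∧
      (∀ p : ℝ, 0 < p → p < 2 → FDRSandwich.SparsityAssumption b₂ b₃ n (η ^ p) →
        FDRSandwich.SandwichOn c₀ c₁ (qs n)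
          (FDRSandwich.alpha q (FDRSandwich.tau (η ^ p)) *
            (n * η ^ p * FDRSandwich.tau (η ^ p) ^ (-p)))
          (FDRSandwich.lpBall n p η) ∧
        FDRSandwich.SandwichOn c₀ c₁ (qs n)
          (FDRSandwich.alpha q (FDRSandwich.tau (η ^ p)) *
            (n * η ^ p * FDRSandwich.tau (η ^ p) ^ (-p)))
          (FDRSandwich.mpBall n p η)) := by
  obtain ⟨c₀, hc₀, h⟩ := FDRSandwich.exists_sandwichOn hb₁ hb₂ hb₃ hQ
  refine ⟨c₀, 1, hc₀, one_pos, fun n hn η hη hη1 => ⟨fun hs => ?_, fun p hp hp2 hs => ⟨?_, ?_⟩⟩⟩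
  · have := h n hn η 0 hη le_rfl zero_le_two hs _ fun μ => FDRSandwich.isSparse_of_mem_l0Ball
    simpa [FDRSandwich.bandwidth, FDRSandwich.discoveryScale] using this
  · exact h n hn (η ^ p) p (Real.rpow_pos_of_pos hη p) hp.le hp2.le hs _
      fun μ => FDRSandwich.isSparse_of_mem_lpBall hp
  · exact h n hn (η ^ p) p (Real.rpow_pos_of_pos hη p) hp.le hp2.le hs _
      fun μ => FDRSandwich.isSparse_of_mem_mpBall hp hη
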